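/- \textbf{Definitions.} A linear polynomial system matrix with transfer function matrix $R(\lambda)\in\mathbb{C}(\lambda)^{m\times n}$ is a block partitioned pencil $$L(\lambda)=\begin{bmatrix} A(\lambda) & -B(\lambda)\\ C(\lambda) & D(\lambda)\end{bmatrix}=\begin{bmatrix}\lambda A_1-A_0 & -\lambda B_1+B_0\\ \lambda C_1-C_0&\lambda D_1-D_0\end{bmatrix}\in\mathbb{C}[\lambda]^{(p+m)\times(p+n)},$$ with $A(\lambda)\in\mathbb{C}[\lambda]^{p\times p}$ and $\det A(\lambda)\not\equiv 0$, such that $R(\lambda)=D(\lambda)+C(\lambda)A(\lambda)^{-1}B(\lambda)$. It is a \emph{strongly minimal linearization} of $R(\lambda)$ if, in addition, $[\,A(\lambda_0)\ \ -B(\lambda_0)\,]$ and $\begin{bmatrix}A(\lambda_0)\\ C(\lambda_0)\end{bmatrix}$ have rank $p$ for every $\lambda_0\in\mathbb{C}$, and $[\,A_1\ \ -B_1\,]$ and $\begin{bmatrix}A_1\\ C_1\end{bmatrix}$ have rank $p$. The \emph{total polar degree of the finite poles} of a rational matrix $R(\lambda)$ is the sum $\sum_{i=1}^r\deg\psi_i$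 of the degrees of the denominators in its Smith--McMillan form $\mathrm{diag}(\varepsilon_1/\psi_1,\dots,\varepsilon_r/\psi_r,0)$; here $R(\lambda)$ is transformed to this form by multiplication on the left and on the right by unimodular polynomial matrices, all $\varepsilon_i,\psi_i$ are monic polynomials, $\varepsilon_i$ and $\psi_i$ are coprime, $\varepsilon_i\mid\varepsilon_{i+1}$ and $\psi_{i+1}\mid\psi_i$. \textbf{Theorem.} Let $R_{sp}(\lambda)\in\mathbb{C}(\lambda)^{m\times n}$ be a strictly proper rational matrix (in every entry the numerator has smaller degree than the denominator) with Laurent expansion around infinity $$R_{sp}(\lambda)=R_{-1}\lambda^{-1}+R_{-2}\lambda^{-2}+R_{-3}\lambda^{-3}+\cdots,$$ convergent for all sufficiently large $\lambda$. For $k\ge 1$ let $H=[R_{-(i+j-1)}]_{i,j=1}^{k}$ and $H_\sigma=[R_{-(i+j)}]_{i,j=1}^{k}$ be the associated $km\times kn$ block Hankel and shifted block Hankel matrices. \begin{enumerate} \item For all sufficiently large $k$, $\operatorname{rank}H$ equals the total polar degree of the finite poles of $R_{sp}(\lambda)$. \item Let $k\ge1$ be such that $r_f:=\operatorname{rank}H$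 equals the total polar degree of the finite poles of $R_{sp}(\lambda)$. Let $U=[\,U_1\ U_2\,]\in\mathbb{C}^{km\times km}$ and $V=[\,V_1\ V_2\,]\in\mathbb{C}^{kn\times kn}$ be unitary matrices, where $U_1$ and $V_1$ have $r_f$ columns, such that $$U^*HV=\begin{bmatrix}\widehat H&0\\0&0\end{bmatrix}$$ with $\widehat H=U_1^*HV_1$ of size $r_f\times r_f$ and invertible. Let $U_{11}$ be the matrix of the first $m$ rows of $U_1$ and $V_{11}$ the matrix of the first $n$ rows of $V_1$. Then $$L_{sp}(\lambda):=\left[\begin{array}{c|c}U_1^*H_\sigma V_1-\lambda\widehat H&\widehat HV_{11}^*\\ \hline U_{11}\widehat H&0\end{array}\right]$$ is a strongly minimal linearization of $R_{sp}(\lambda)$ (with $A(\lambda)=U_1^*H_\sigma V_1-\lambda\widehat H$). In particular, $$R_{sp}(\lambda)=U_{11}\widehat H\,(\lambda\widehat H-U_1^*H_\sigma V_1)^{-1}\,\widehat HV_{11}^*.$$ \end{enumerate} -/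

import Mathlib

open Polynomial Matrix Filter

noncomputable section

/-- A rational matrix over `ℂ` is strictly proper if every entry has numerator degree smaller than
denominator degree (the zero function counts, its numerator having degree `⊥`). -/
def IsStrictlyProper {m n : ℕ} (R : Matrix (Fin m) (Fin n) (RatFunc ℂ)) : Prop :=
  ∀ i j, (R i j).num.degree < (R i j).denom.degree

/-- `R(λ) = c 1 * λ⁻¹ + c 2 * λ⁻² + c 3 * λ⁻³ + ⋯`, convergent for all sufficiently large `λ`.
The matrix `c l` is the Laurent coefficient `R_{-l}`, `l ≥ 1`; the value `c 0` plays no role. -/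
def HasLaurentExpansionAtInfinity {m n : ℕ} (R : Matrix (Fin m) (Fin n) (RatFunc ℂ))
    (c : ℕ → Matrix (Fin m) (Fin n) ℂ) : Prop :=
  ∃ ρ : ℝ, ∀ z : ℂ, ρ < ‖z‖ → ∀ i j,
    HasSum (fun l : ℕ => c (l + 1) i j * (z ^ (l + 1))⁻¹) (RatFunc.eval (RingHom.id ℂ) z (R i j))

/-- The block Hankel matrix with `k × k` blocks, whose block in position `(a, b)`
(numbered from `0`) is `R_{-(a+b+1)}`. -/
def blockHankel {m n : ℕ} (c : ℕ → Matrix (Fin m) (Fin n) ℂ) (k : ℕ) :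
    Matrix (Fin k × Fin m) (Fin k × Fin n) ℂ :=
  Matrix.of fun a b => c (a.1.val + b.1.val + 1) a.2 b.2

/-- The shifted block Hankel matrix with `k × k` blocks, whose block in position `(a, b)`
(numbered from `0`) is `R_{-(a+b+2)}`. -/
def shiftedBlockHankel {m n : ℕ} (c : ℕ → Matrix (Fin m) (Fin n) ℂ) (k : ℕ) :
    Matrix (Fin k × Fin m) (Fin k × Fin n) ℂ :=
  Matrix.of fun a b => c (a.1.val + b.1.val + 2) a.2 b.2

/-- The `m × n` matrix `diag(ε₁/ψ₁, …, ε_r/ψ_r, 0)`. -/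
def diagQuotient (m n : ℕ) {r : ℕ} (ε ψ : Fin r → ℂ[X]) :
    Matrix (Fin m) (Fin n) (RatFunc ℂ) :=
  Matrix.of fun i j =>
    if h : i.val = j.val ∧ i.val < r then
      algebraMap ℂ[X] (RatFunc ℂ) (ε ⟨i.val, h.2⟩) / algebraMap ℂ[X] (RatFunc ℂ) (ψ ⟨i.val, h.2⟩)
    else 0

/-- `diag(ε₁/ψ₁, …, ε_r/ψ_r, 0)` is the (global, finite) Smith--McMillan form of `R`. -/
structure IsSmithMcMillanForm {m n : ℕ} (R : Matrix (Fin m) (Fin n) (RatFunc ℂ))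
    {r : ℕ} (ε ψ : Fin r → ℂ[X]) : Prop where
  le_rows : r ≤ m
  le_cols : r ≤ n
  monic_num : ∀ i, (ε i).Monic
  monic_den : ∀ i, (ψ i).Monic
  coprime : ∀ i, IsCoprime (ε i) (ψ i)
  num_dvd : ∀ i j, i ≤ j → ε i ∣ ε j
  den_dvd : ∀ i j, i ≤ j → ψ j ∣ ψ i
  /-- `R` is transformed into the diagonal form by unimodular polynomial matrices. -/
  equivalent : ∃ (M : Matrix (Fin m) (Fin m) ℂ[X]) (N : Matrix (Fin n) (Fin n) ℂ[X]),
    IsUnit M ∧ IsUnit N ∧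
      M.map (algebraMap ℂ[X] (RatFunc ℂ)) * R * N.map (algebraMap ℂ[X] (RatFunc ℂ)) =
        diagQuotient m n ε ψ

/-- `d` is the total polar degree of the finite poles of `R`: the sum of the degrees of the
denominators in the Smith--McMillan form of `R`. -/
def IsFinitePolarDegree {m n : ℕ} (R : Matrix (Fin m) (Fin n) (RatFunc ℂ)) (d : ℕ) : Prop :=
  ∃ (r : ℕ) (ε ψ : Fin r → ℂ[X]), IsSmithMcMillanForm R ε ψ ∧ d = ∑ i, (ψ i).natDegree

/-- `L = [A, -B; C, D]`, partitioned with `A` of size `p × p`, is a linear polynomial system matrix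
with transfer function matrix `R`: all entries have degree at most one, `A` is regular, and
`R = D + C A⁻¹ B`. -/
structure IsLinearSystemMatrix {p m n : ℕ} (L : Matrix (Fin p ⊕ Fin m) (Fin p ⊕ Fin n) ℂ[X])
    (R : Matrix (Fin m) (Fin n) (RatFunc ℂ)) : Prop where
  linear : ∀ i j, (L i j).natDegree ≤ 1
  regular : L.toBlocks₁₁.det ≠ 0
  transfer : R = L.toBlocks₂₂.map (algebraMap ℂ[X] (RatFunc ℂ)) +
    L.toBlocks₂₁.map (algebraMap ℂ[X] (RatFunc ℂ)) *
      (L.toBlocks₁₁.map (algebraMap ℂ[X] (RatFunc ℂ)))⁻¹ *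
        (-L.toBlocks₁₂).map (algebraMap ℂ[X] (RatFunc ℂ))

/-- Strong minimality of a pencil `L = [A, -B; C, D]`: the pencils `[A, -B]` and `[A; C]` have
full row rank and full column rank, respectively, at every finite point, and so do their
coefficient matrices of `λ` (minimality at infinity). -/
structure IsStronglyMinimal {p m n : ℕ}
    (L : Matrix (Fin p ⊕ Fin m) (Fin p ⊕ Fin n) ℂ[X]) : Prop where
  rows_finite : ∀ z : ℂ, ((fromCols L.toBlocks₁₁ L.toBlocks₁₂).map (Polynomial.eval z)).rank = p
  cols_finite : ∀ z : ℂ, ((fromRows L.toBlocks₁₁ L.toBlocks₂₁).map (Polynomial.eval z)).rank = p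
  rows_infinity : ((fromCols L.toBlocks₁₁ L.toBlocks₁₂).map fun q => q.coeff 1).rank = p
  cols_infinity : ((fromRows L.toBlocks₁₁ L.toBlocks₂₁).map fun q => q.coeff 1).rank = p

/-- `L` is a strongly minimal linearization of the rational matrix `R`. -/
def IsStronglyMinimalLinearization {p m n : ℕ}
    (L : Matrix (Fin p ⊕ Fin m) (Fin p ⊕ Fin n) ℂ[X])
    (R : Matrix (Fin m) (Fin n) (RatFunc ℂ)) : Prop :=
  IsLinearSystemMatrix L R ∧ IsStronglyMinimal L

/-- A matrix whose columns are indexed by a possibly different type is unitary (hence square). -/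
def IsUnitaryMatrix {ι κ : Type*} [Fintype ι] [Fintype κ] [DecidableEq ι] [DecidableEq κ]
    (U : Matrix ι κ ℂ) : Prop :=
  Uᴴ * U = 1 ∧ U * Uᴴ = 1

/-- The first block row (the first `m` rows) of a matrix with `k ≥ 1` block rows of height `m`. -/
def firstBlockRow {k m r : ℕ} (hk : 0 < k) (U : Matrix (Fin k × Fin m) (Fin r) ℂ) :
    Matrix (Fin m) (Fin r) ℂ :=
  Matrix.of fun i j => U (⟨0, hk⟩, i) j

/-- The pencil `[S - λ Ĥ, Ĥ W*; Z Ĥ, 0]`; it is used with `S = U₁* H_σ V₁`, `Z = U₁₁`, `W = V₁₁`. -/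
def hankelPencil {m n r : ℕ} (S Hhat : Matrix (Fin r) (Fin r) ℂ)
    (Z : Matrix (Fin m) (Fin r) ℂ) (W : Matrix (Fin n) (Fin r) ℂ) :
    Matrix (Fin r ⊕ Fin m) (Fin r ⊕ Fin n) ℂ[X] :=
  fromBlocks (S.map Polynomial.C - (Polynomial.X : ℂ[X]) • Hhat.map Polynomial.C)
    ((Hhat * Wᴴ).map Polynomial.C) ((Z * Hhat).map Polynomial.C) 0

end

/-! The proof factors both Hankel matrices through a minimal state space realization. The Hankel
operator of R sends a polynomial vector u to the coefficients of λ⁻¹, λ⁻², … in R u; its kernel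
consists of the u for which R u is polynomial. If M R N is the Smith–McMillan form, this kernel is
cut out by the conditions ψᵢ ∣ (N⁻¹u)ᵢ, so the range is isomorphic to ∏ ℂ[X]/(ψᵢ), and its dimension
d is the total polar degree (`finrank_range_hankelOperator`). Multiplication by λ acts on the range
as the left shift. With the shift as A, the images of the unit vectors as B and the reading of the
first coefficient as C, one gets R₋₍ₗ₊₁₎ = C Aˡ B with d states, observable and reachable
(`exists_realization`).

Hence H = O K and H_σ = O A K, where O and K are the observability and reachability matrices. For
large k both have rank d, and so has their product (`eventually_rank_blockHankel`). Conversely, if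
rank H = d for some k, then O and K have rank d for that k. The compression then gives U₁U₁* O = O
and K V₁V₁* = K. With P = U₁* O and Q = K V₁, both invertible, this yields Ĥ = P Q, U₁* H_σ V₁ = P A
Q, U₁₁ Ĥ = C Q and Ĥ V₁₁* = P B. The pencil is therefore diag(P, I) · [A − λ, B; C, 0] · diag(Q, I).
Its transfer function is C (λ − A)⁻¹ B = R (`isLinearSystemMatrix_of_realization`), and strong
minimality is the Popov–Belevitch–Hautus eigenvector test together with invertibility of Ĥ
(`isStronglyMinimal_of_realization`).

Two results prepare the ground: existence of the form (`exists_smithMcMillanForm`) and the agreement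
of the convergent expansion with the formal one (`laurentAtInfinity_eq_strictlyProperSeries`). -/

/-! ### Smith normal form of a polynomial matrix over a field. -/

section SmithForm

/-- Two polynomial matrices are unimodularly equivalent. -/
def UnimodularEquiv {R : Type*} [CommRing R] {m n : ℕ} (P Q : Matrix (Fin m) (Fin n) R) : Prop :=
  ∃ (M : Matrix (Fin m) (Fin m) R) (N : Matrix (Fin n) (Fin n) R),
    IsUnit M ∧ IsUnit N ∧ M * P * N = Q

/-- The block diagonal matrix `diag(a, M)` with a `1 × 1` leading block. -/
def bordered {R : Type*} [CommRing R] {m n : ℕ} (a : R) (M : Matrix (Fin m) (Fin n) R) :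
    Matrix (Fin (m + 1)) (Fin (n + 1)) R :=
  Matrix.of fun i j => Fin.cases (Fin.cases a (fun _ => 0) j) (fun i' => Fin.cases 0 (M i') j) i

/-- The lower unitriangular matrix whose first column is `(1, q)`, and which is otherwise the
identity. -/
def columnClearing {R : Type*} [CommRing R] {m : ℕ} (q : Fin m → R) :
    Matrix (Fin (m + 1)) (Fin (m + 1)) R :=
  Matrix.of fun i j => Fin.cases (Fin.cases 1 (fun _ => 0) j)
    (fun i' => Fin.cases (q i') ((1 : Matrix (Fin m) (Fin m) R) i') j) i

variable {R : Type*} [CommRing R] {m n l : ℕ}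

@[simp] lemma bordered_zero_zero (a : R) (M : Matrix (Fin m) (Fin n) R) :
    bordered a M 0 0 = a := rfl
@[simp] lemma bordered_zero_succ (a : R) (M : Matrix (Fin m) (Fin n) R) (j : Fin n) :
    bordered a M 0 j.succ = 0 := rfl
@[simp] lemma bordered_succ_zero (a : R) (M : Matrix (Fin m) (Fin n) R) (i : Fin m) :
    bordered a M i.succ 0 = 0 := rfl
@[simp] lemma bordered_succ_succ (a : R) (M : Matrix (Fin m) (Fin n) R) (i : Fin m) (j : Fin n) :
    bordered a M i.succ j.succ = M i j := rfl
@[simp] lemma columnClearing_zero_zero (q : Fin m → R) : columnClearing q 0 0 = 1 := rfl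
@[simp] lemma columnClearing_zero_succ (q : Fin m → R) (j : Fin m) :
    columnClearing q 0 j.succ = 0 := rfl
@[simp] lemma columnClearing_succ_zero (q : Fin m → R) (i : Fin m) :
    columnClearing q i.succ 0 = q i := rfl
@[simp] lemma columnClearing_succ_succ (q : Fin m → R) (i j : Fin m) :
    columnClearing q i.succ j.succ = (1 : Matrix (Fin m) (Fin m) R) i j := rfl

lemma bordered_mul (a b : R) (M : Matrix (Fin m) (Fin n) R) (N : Matrix (Fin n) (Fin l) R) :
    bordered a M * bordered b N = bordered (a * b) (M * N) := by
  ext i j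
  refine Fin.cases ?_ (fun i => ?_) i <;> refine Fin.cases ?_ (fun j => ?_) j <;>
    simp [Matrix.mul_apply, Fin.sum_univ_succ]

lemma bordered_one : bordered (1 : R) (1 : Matrix (Fin m) (Fin m) R) = 1 := by
  ext i j
  refine Fin.cases ?_ (fun i => ?_) i <;> refine Fin.cases ?_ (fun j => ?_) j <;>
    simp [Matrix.one_apply, Fin.succ_ne_zero, (Fin.succ_ne_zero _).symm]

lemma isUnit_bordered_one {M : Matrix (Fin m) (Fin m) R} (h : IsUnit M) :
    IsUnit (bordered (1 : R) M) := by
  obtain ⟨u, rfl⟩ := h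
  refine IsUnit.of_mul_eq_one (bordered 1 (↑u⁻¹ : Matrix (Fin m) (Fin m) R)) ?_
  rw [bordered_mul, Units.mul_inv, mul_one, bordered_one]

lemma isUnit_columnClearing (q : Fin m → R) : IsUnit (columnClearing q) := by
  refine IsUnit.of_mul_eq_one (columnClearing (-q)) ?_
  ext i j
  refine Fin.cases ?_ (fun i => ?_) i <;> refine Fin.cases ?_ (fun j => ?_) j <;>
    simp [Matrix.mul_apply, Fin.sum_univ_succ, Matrix.one_apply, Fin.succ_ne_zero,
      (Fin.succ_ne_zero _).symm]

namespace UnimodularEquiv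

lemma refl (P : Matrix (Fin m) (Fin n) R) : UnimodularEquiv P P :=
  ⟨1, 1, isUnit_one, isUnit_one, by simp⟩

lemma trans {P Q S : Matrix (Fin m) (Fin n) R} (h : UnimodularEquiv P Q)
    (h' : UnimodularEquiv Q S) : UnimodularEquiv P S := by
  obtain ⟨M, N, hM, hN, rfl⟩ := h
  obtain ⟨M', N', hM', hN', rfl⟩ := h'
  exact ⟨M' * M, N * N', hM'.mul hM, hN.mul hN', by simp only [Matrix.mul_assoc]⟩

lemma mul_left (P : Matrix (Fin m) (Fin n) R) {M : Matrix (Fin m) (Fin m) R} (h : IsUnit M) :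
    UnimodularEquiv P (M * P) := ⟨M, 1, h, isUnit_one, by simp⟩

lemma mul_right (P : Matrix (Fin m) (Fin n) R) {N : Matrix (Fin n) (Fin n) R} (h : IsUnit N) :
    UnimodularEquiv P (P * N) := ⟨1, N, isUnit_one, h, by simp⟩

lemma bordered {P Q : Matrix (Fin m) (Fin n) R} (a : R) (h : UnimodularEquiv P Q) :
    UnimodularEquiv (bordered a P) (_root_.bordered a Q) := by
  obtain ⟨M, N, hM, hN, rfl⟩ := h
  exact ⟨_, _, isUnit_bordered_one hM, isUnit_bordered_one hN, by simp [bordered_mul]⟩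

lemma dvd {P Q : Matrix (Fin m) (Fin n) R} (h : UnimodularEquiv P Q) {d : R}
    (hd : ∀ i j, d ∣ P i j) (i : Fin m) (j : Fin n) : d ∣ Q i j := by
  obtain ⟨M, N, -, -, rfl⟩ := h
  simp only [Matrix.mul_apply]
  exact Finset.dvd_sum fun b _ => Dvd.dvd.mul_right
    (Finset.dvd_sum fun a _ => Dvd.dvd.mul_left (hd _ _) _) _

lemma permute (P : Matrix (Fin m) (Fin n) R) (σ : Equiv.Perm (Fin m)) (τ : Equiv.Perm (Fin n)) :
    UnimodularEquiv P (P.submatrix σ τ) := by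
  refine ⟨(1 : Matrix _ _ R).submatrix σ id, (1 : Matrix _ _ R).submatrix id τ, ?_, ?_, ?_⟩
  · refine IsUnit.of_mul_eq_one ((1 : Matrix _ _ R).submatrix id σ) ?_
    ext i j
    simp [Matrix.mul_apply, Matrix.one_apply]
  · refine IsUnit.of_mul_eq_one ((1 : Matrix _ _ R).submatrix τ id) (mul_eq_one_comm.1 ?_)
    ext i j
    simp [Matrix.mul_apply, Matrix.one_apply]
  · ext i j
    simp [Matrix.mul_apply, Matrix.one_apply]

end UnimodularEquiv

lemma isUnit_transvection {i j : Fin m} (h : i ≠ j) (c : R) :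
    IsUnit (Matrix.transvection i j c) := by
  rw [Matrix.isUnit_iff_isUnit_det, Matrix.det_transvection_of_ne i j h]
  exact isUnit_one

variable {F : Type*} [Field F]

/-- A nonzero polynomial matrix can be transformed so that its leading entry is monic and has the
least degree among all nonzero entries of all equivalent matrices. -/
lemma exists_minimal_corner {P : Matrix (Fin (m + 1)) (Fin (n + 1)) F[X]} (hP : P ≠ 0) :
    ∃ Q, UnimodularEquiv P Q ∧ (Q 0 0).Monic ∧ ∀ Q', UnimodularEquiv P Q' → ∀ i j,
      Q' i j ≠ 0 → (Q 0 0).natDegree ≤ (Q' i j).natDegree := by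
  classical
  let S : Set ℕ := {d | ∃ Q, UnimodularEquiv P Q ∧ ∃ i j, Q i j ≠ 0 ∧ (Q i j).natDegree = d}
  have hS : S.Nonempty := by
    obtain ⟨i, j, hij⟩ : ∃ i j, P i j ≠ 0 := by
      by_contra! h
      exact hP (by ext1 i j; exact h i j)
    exact ⟨_, P, .refl P, i, j, hij, rfl⟩
  obtain ⟨Q, hQ, i, j, hij, hdeg⟩ := Nat.sInf_mem hS
  have hlc : (Q i j).leadingCoeff ≠ 0 := leadingCoeff_ne_zero.2 hij
  have hunit : IsUnit ((Polynomial.C (Q i j).leadingCoeff⁻¹) •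
      (1 : Matrix (Fin (m + 1)) (Fin (m + 1)) F[X])) := by
    refine IsUnit.of_mul_eq_one (Polynomial.C (Q i j).leadingCoeff • 1) ?_
    rw [Matrix.smul_mul, Matrix.mul_smul, smul_smul, ← Polynomial.C_mul, inv_mul_cancel₀ hlc]
    simp
  refine ⟨_, (hQ.trans (.permute Q (Equiv.swap 0 i) (Equiv.swap 0 j))).trans
    (.mul_left _ hunit), ?_, ?_⟩
  · simp only [Matrix.smul_mul, Matrix.one_mul, Matrix.smul_apply, Matrix.submatrix_apply,
      Equiv.swap_apply_left, smul_eq_mul]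
    rw [mul_comm]
    exact monic_mul_leadingCoeff_inv hij
  · intro Q' hQ' a b hab
    simp only [Matrix.smul_mul, Matrix.one_mul, Matrix.smul_apply, Matrix.submatrix_apply,
      Equiv.swap_apply_left, smul_eq_mul]
    rw [mul_comm, natDegree_mul_leadingCoeff_inv _ hij, hdeg]
    exact Nat.sInf_le ⟨Q', hQ', a, b, hab, rfl⟩

/-- The remainder of p modulo d has the form p + c d and degree below that of d, so minimality
forces it to vanish. -/
lemma dvd_of_minimal {d p : F[X]} (hd : d.Monic)
    (h : ∀ c, p + c * d ≠ 0 → d.natDegree ≤ (p + c * d).natDegree) : d ∣ p := by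
  by_contra hnd
  have hmod : p + (-(p /ₘ d)) * d = p %ₘ d := by
    rw [modByMonic_eq_sub_mul_div]; ring
  have h0 : p %ₘ d ≠ 0 := fun h0 => hnd ((modByMonic_eq_zero_iff_dvd hd).1 h0)
  have h1 := h (-(p /ₘ d))
  rw [hmod] at h1
  have h2 := degree_modByMonic_lt p hd
  have h3 := natDegree_lt_natDegree h0 h2
  exact absurd (h1 h0) (not_le.2 h3)

/-- The Smith normal form of a polynomial matrix. -/
theorem exists_smithForm (m n : ℕ) (P : Matrix (Fin m) (Fin n) F[X]) :
    ∃ s : ℕ → F[X], UnimodularEquiv P (Matrix.of fun i j => if i.val = j.val then s i else 0) ∧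
      (∀ i, s i = 0 ∨ (s i).Monic) ∧ (∀ i, s i ∣ s (i + 1)) ∧
      ∀ d, (∀ i j, d ∣ P i j) → ∀ i, d ∣ s i := by
  induction m generalizing n with
  | zero => exact ⟨0, by convert UnimodularEquiv.refl P; ext1 i; exact i.elim0, by simp, by simp, by simp⟩
  | succ m ih =>
    cases n with
    | zero =>
      exact ⟨0, by convert UnimodularEquiv.refl P; ext1 i j; exact j.elim0, by simp, by simp,
        by simp⟩
    | succ n =>
      by_cases hP : P = 0
      · subst hP
        refine ⟨0, ?_, by simp, by simp, by simp⟩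
        convert UnimodularEquiv.refl (0 : Matrix (Fin (m + 1)) (Fin (n + 1)) F[X])
        simp
        rfl
      obtain ⟨Q, hQ, hmon, hmin⟩ := exists_minimal_corner hP
      set d := Q 0 0 with hd
      have hcol : ∀ Q', UnimodularEquiv P Q' → Q' 0 0 = d → ∀ i : Fin m, d ∣ Q' i.succ 0 := by
        intro Q' hQ' h0 i
        refine dvd_of_minimal hmon fun c => ?_
        have := hmin _ (hQ'.trans (.mul_left _ (isUnit_transvection (Fin.succ_ne_zero i) c)))
          i.succ 0
        rwa [Matrix.transvection_mul_apply_same, h0] at this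
      -- Quantified over all equivalent matrices with corner d, because it is applied below to a
      -- matrix other than Q.
      have hrow : ∀ Q', UnimodularEquiv P Q' → Q' 0 0 = d → ∀ j : Fin n, d ∣ Q' 0 j.succ := by
        intro Q' hQ' h0 j
        refine dvd_of_minimal hmon fun c => ?_
        have := hmin _ (hQ'.trans (.mul_right _
          (isUnit_transvection (Fin.succ_ne_zero j).symm c))) 0 j.succ
        rwa [Matrix.mul_transvection_apply_same, h0] at this
      choose a ha using hcol Q hQ rfl
      choose b hb using hrow Q hQ rfl
      -- The Schur complement of the corner: the border is d a and d b, so no division is needed.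
      let Q₂ : Matrix (Fin m) (Fin n) F[X] := Matrix.of fun i j =>
        Q i.succ j.succ - a i * d * b j
      have hQ₂ : UnimodularEquiv P (bordered d Q₂) := by
        refine hQ.trans
          ⟨columnClearing (-a), (columnClearing (-b))ᵀ, isUnit_columnClearing _, ?_, ?_⟩
        · rw [Matrix.isUnit_iff_isUnit_det, Matrix.det_transpose,
            ← Matrix.isUnit_iff_isUnit_det]
          exact isUnit_columnClearing _
        · ext1 i j
          refine Fin.cases ?_ (fun i => ?_) i <;> refine Fin.cases ?_ (fun j => ?_) j <;>
            simp [Matrix.mul_apply, Fin.sum_univ_succ, Matrix.one_apply, ha, hb, Q₂, ← hd] <;>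
            ring
      -- Adding a lower row to the first one keeps the corner d and moves a row of Q₂ into the first
      -- row, where `hrow` applies.
      have hdvd : ∀ i j, d ∣ Q₂ i j := by
        intro i j
        have h := hrow _ (hQ₂.trans (.mul_left _
          (isUnit_transvection (Fin.succ_ne_zero i).symm 1))) ?_ j
        · rw [Matrix.transvection_mul_apply_same] at h
          simpa using h
        · rw [Matrix.transvection_mul_apply_same]
          simp
      obtain ⟨s, hs, hmonic, hchain, hcommon⟩ := ih n Q₂
      -- The common divisor clause of the induction hypothesis supplies the only new link of the
      -- chain, d ∣ s 0.
      refine ⟨fun i => Nat.casesOn i d s, ?_, ?_, ?_, ?_⟩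
      · convert hQ₂.trans (hs.bordered d) using 1
        ext1 i j
        refine Fin.cases ?_ (fun i => ?_) i <;> refine Fin.cases ?_ (fun j => ?_) j <;> simp
      · rintro (_ | i)
        exacts [Or.inr hmon, hmonic i]
      · rintro (_ | i)
        exacts [hcommon d hdvd 0, hchain i]
      · intro e he
        have h := hQ₂.dvd he
        rintro (_ | i)
        · exact h 0 0
        · exact hcommon e (fun i j => h i.succ j.succ) i

end SmithForm

/-! ### Existence of the Smith–McMillan form. -/

section SmithMcMillan

variable {m n : ℕ}

lemma exists_common_denominator (R : Matrix (Fin m) (Fin n) (RatFunc ℂ)) :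
    ∃ q : ℂ[X], q.Monic ∧ ∃ P : Matrix (Fin m) (Fin n) ℂ[X], ∀ i j,
      R i j = algebraMap ℂ[X] (RatFunc ℂ) (P i j) / algebraMap ℂ[X] (RatFunc ℂ) q := by
  obtain ⟨q, hq, hdvd⟩ : ∃ q : ℂ[X], q.Monic ∧ ∀ i j, (R i j).denom ∣ q :=
    ⟨∏ i, ∏ j, (R i j).denom,
      monic_prod_of_monic _ _ fun i _ => monic_prod_of_monic _ _ fun j _ => (R i j).monic_denom,
      fun i j => (Finset.dvd_prod_of_mem (fun j => (R i j).denom) (Finset.mem_univ j)).trans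
        (Finset.dvd_prod_of_mem (fun i => ∏ j, (R i j).denom) (Finset.mem_univ i))⟩
  choose P hP using fun i j => (RatFunc.denom_dvd hq.ne_zero).1 (hdvd i j)
  exact ⟨q, hq, P, hP⟩

/-- Reduced fractions are normalized through the denominator only; comparing leading coefficients
after cross-multiplication handles the numerator. -/
lemma monic_num_div {p q : ℂ[X]} (hp : p.Monic) (hq : q.Monic) :
    (algebraMap ℂ[X] (RatFunc ℂ) p / algebraMap ℂ[X] (RatFunc ℂ) q).num.Monic := by
  have h := (RatFunc.num_mul_eq_mul_denom_iff hq.ne_zero).2 (rfl : algebraMap ℂ[X] (RatFunc ℂ) p / algebraMap ℂ[X] (RatFunc ℂ) q = _)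
  have := congrArg leadingCoeff h
  rwa [leadingCoeff_mul, leadingCoeff_mul, hq.leadingCoeff, hp.leadingCoeff,
    (RatFunc.monic_denom _).leadingCoeff, mul_one, mul_one] at this

/-- Every rational matrix has a Smith--McMillan form. -/
theorem exists_smithMcMillanForm (R : Matrix (Fin m) (Fin n) (RatFunc ℂ)) :
    ∃ (r : ℕ) (ε ψ : Fin r → ℂ[X]), IsSmithMcMillanForm R ε ψ := by
  classical
  obtain ⟨q, hq, P, hP⟩ := exists_common_denominator R
  obtain ⟨s, ⟨M, N, hM, hN, hs⟩, hmonic, hchain, -⟩ := exists_smithForm m n P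
  have hdvd : ∀ i j, i ≤ j → s i ∣ s j := fun i j h => by
    induction h with
    | refl => exact dvd_rfl
    | step _ ih => exact ih.trans (hchain _)
  -- The rank r is the first index at which the diagonal ends or vanishes; by the divisibility chain
  -- it vanishes from there on.
  have hex : ∃ r, r = min m n ∨ s r = 0 := ⟨_, Or.inl rfl⟩
  set r := Nat.find hex with hr
  have hle : r ≤ min m n := Nat.find_min' hex (Or.inl rfl)
  have hne : ∀ i < r, s i ≠ 0 := fun i hi h => Nat.find_min hex hi (Or.inr h)
  have hzero : ∀ i, r ≤ i → i < min m n → s i = 0 := fun i hi hi' => by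
    rcases Nat.find_spec hex with h | h
    · omega
    · exact zero_dvd_iff.1 (h ▸ hdvd _ _ hi)
  have hq0 : algebraMap ℂ[X] (RatFunc ℂ) q ≠ 0 := by
    simpa using hq.ne_zero
  let x : Fin r → RatFunc ℂ := fun i =>
    algebraMap ℂ[X] (RatFunc ℂ) (s i) / algebraMap ℂ[X] (RatFunc ℂ) q
  have hx : ∀ i, x i ≠ 0 := fun i => div_ne_zero (by simpa using hne i i.2) hq0
  refine ⟨r, fun i => (x i).num, fun i => (x i).denom, ⟨by omega, by omega,
    fun i => monic_num_div ((hmonic i).resolve_left (hne i i.2)) hq,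
    fun i => RatFunc.monic_denom _, fun i => RatFunc.isCoprime_num_denom _, ?_, ?_,
    M, N, hM, hN, ?_⟩⟩
  -- From s j = s i · t follows x j = x i · t. Thus x i can be written with numerator num (x j), and
  -- below x j with denominator denom (x i); both divisibilities result.
  · intro i j hij
    obtain ⟨t, ht⟩ := hdvd i j hij
    have ht0 : t ≠ 0 := by rintro rfl; exact hne j j.2 (by simpa using ht)
    refine (RatFunc.num_dvd (RatFunc.num_ne_zero (hx j))).2
      ⟨(x j).denom * t, mul_ne_zero (RatFunc.denom_ne_zero _) ht0, ?_⟩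
    have ht0' : algebraMap ℂ[X] (RatFunc ℂ) t ≠ 0 := by simpa using ht0
    rw [map_mul, ← div_div, RatFunc.num_div_denom]
    simp only [x, ht, map_mul]
    field_simp
  · intro i j hij
    obtain ⟨t, ht⟩ := hdvd i j hij
    refine (RatFunc.denom_dvd (RatFunc.denom_ne_zero _)).2 ⟨(x i).num * t, ?_⟩
    rw [map_mul, mul_div_right_comm, RatFunc.num_div_denom]
    simp only [x, ht, map_mul]
    field_simp
  · have hR : R = (algebraMap ℂ[X] (RatFunc ℂ) q)⁻¹ • P.map (algebraMap ℂ[X] (RatFunc ℂ)) := by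
      ext1 i j
      simp [hP, div_eq_inv_mul]
    rw [hR, Matrix.mul_smul, Matrix.smul_mul, ← Matrix.map_mul, ← Matrix.map_mul, hs]
    ext1 i j
    simp only [Matrix.smul_apply, Matrix.map_apply, Matrix.of_apply, diagQuotient, smul_eq_mul]
    by_cases hij : i.val = j.val
    · by_cases hir : i.val < r
      · rw [if_pos hij, dif_pos ⟨hij, hir⟩, RatFunc.num_div_denom]
        exact (div_eq_inv_mul _ _).symm
      · have := hzero i (by omega) (by omega)
        rw [dif_neg (by tauto), if_pos hij, this]
        simp
    · simp [hij]

end SmithMcMillan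

noncomputable section

/-! ### Formal Laurent series at infinity, in the uniformizer λ⁻¹. -/

section Laurent

/-- Expansion at infinity of a polynomial: the substitution of the inverse of the uniformizer. -/
def polynomialAtInfinity : ℂ[X] →+* LaurentSeries ℂ :=
  Polynomial.eval₂RingHom HahnSeries.C (HahnSeries.single (-1) 1)

lemma coeff_single_neg_one_mul (f : LaurentSeries ℂ) (e : ℤ) :
    (HahnSeries.single (-1 : ℤ) (1 : ℂ) * f).coeff e = f.coeff (e + 1) := by
  have := HahnSeries.coeff_single_mul_add (r := (1 : ℂ)) (x := f) (a := e + 1) (b := (-1 : ℤ))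
  simpa using this

lemma coeff_single_neg_one_pow_mul (f : LaurentSeries ℂ) (b : ℕ) (e : ℤ) :
    (HahnSeries.single (-1 : ℤ) (1 : ℂ) ^ b * f).coeff e = f.coeff (e + b) := by
  induction b generalizing e with
  | zero => simp
  | succ b ih =>
    rw [pow_succ', mul_assoc, coeff_single_neg_one_mul, ih]
    push_cast
    ring_nf

lemma coeff_C_mul (a : ℂ) (f : LaurentSeries ℂ) (e : ℤ) :
    (HahnSeries.C a * f).coeff e = a * f.coeff e := by
  rw [HahnSeries.C_mul_eq_smul]; rfl

@[simp] lemma polynomialAtInfinity_C (a : ℂ) :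
    polynomialAtInfinity (Polynomial.C a) = HahnSeries.C a := by
  simp [polynomialAtInfinity]

@[simp] lemma polynomialAtInfinity_X :
    polynomialAtInfinity Polynomial.X = HahnSeries.single (-1) 1 := by
  simp [polynomialAtInfinity]

lemma coeff_polynomialAtInfinity (p : ℂ[X]) (e : ℤ) :
    (polynomialAtInfinity p).coeff e = if e ≤ 0 then p.coeff (-e).toNat else 0 := by
  induction p using Polynomial.induction_on' with
  | add p q hp hq =>
    rw [map_add, HahnSeries.coeff_add, hp, hq]
    split_ifs <;> simp
  | monomial b a =>
    rw [← Polynomial.C_mul_X_pow_eq_monomial, map_mul, map_pow, polynomialAtInfinity_C,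
      polynomialAtInfinity_X, coeff_C_mul, ← mul_one (HahnSeries.single (-1 : ℤ) (1 : ℂ) ^ b),
      coeff_single_neg_one_pow_mul, HahnSeries.coeff_one, Polynomial.coeff_C_mul_X_pow]
    by_cases h : e + b = 0
    · have h1 : e ≤ 0 := by omega
      have h2 : (-e).toNat = b := by omega
      simp [h, h1, h2]
    · by_cases h1 : e ≤ 0
      · have h2 : (-e).toNat ≠ b := by omega
        simp [h, h1, h2]
      · simp [h, h1]

lemma polynomialAtInfinity_injective : Function.Injective polynomialAtInfinity := by
  intro p q h
  ext b
  have := congrArg (fun f => HahnSeries.coeff f (-(b : ℤ))) h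
  simpa [coeff_polynomialAtInfinity] using this

/-- A Laurent series all of whose coefficients of positive index vanish is the expansion of a
polynomial. -/
lemma exists_polynomialAtInfinity_eq {f : LaurentSeries ℂ} (hf : ∀ l : ℕ, f.coeff (l + 1) = 0) :
    ∃ p, polynomialAtInfinity p = f := by
  -- No exponent lies below the order, so the polynomial has degree at most −order; the added 1
  -- keeps that top term in the range.
  let N := (-f.order).toNat + 1
  refine ⟨∑ b ∈ Finset.range N, Polynomial.monomial b (f.coeff (-(b : ℤ))), ?_⟩
  ext e
  rw [coeff_polynomialAtInfinity]
  split_ifs with he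
  · simp only [Polynomial.finsetSum_coeff, Polynomial.coeff_monomial, Finset.sum_ite_eq',
      Finset.mem_range]
    split_ifs with h
    · congr 1; omega
    · exact (HahnSeries.coeff_eq_zero_of_lt_order (by omega)).symm
  · obtain ⟨l, rfl⟩ : ∃ l : ℕ, e = l + 1 := ⟨(e - 1).toNat, by omega⟩
    exact (hf l).symm

/-- The Laurent expansion at infinity of a rational function. -/
def laurentAtInfinity : RatFunc ℂ →+* LaurentSeries ℂ :=
  RatFunc.liftRingHom polynomialAtInfinity
    (nonZeroDivisors_le_comap_nonZeroDivisors_of_injective _ polynomialAtInfinity_injective)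

@[simp] lemma laurentAtInfinity_algebraMap (p : ℂ[X]) :
    laurentAtInfinity (algebraMap ℂ[X] (RatFunc ℂ) p) = polynomialAtInfinity p := by
  simp [laurentAtInfinity]

@[simp] lemma laurentAtInfinity_X :
    laurentAtInfinity RatFunc.X = HahnSeries.single (-1) 1 := by
  rw [← RatFunc.algebraMap_X, laurentAtInfinity_algebraMap, polynomialAtInfinity_X]

@[simp] lemma laurentAtInfinity_algebraMap_const (a : ℂ) :
    laurentAtInfinity (algebraMap ℂ (RatFunc ℂ) a) = HahnSeries.C a := by
  rw [IsScalarTower.algebraMap_apply ℂ ℂ[X] (RatFunc ℂ), laurentAtInfinity_algebraMap,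
    Polynomial.algebraMap_eq, polynomialAtInfinity_C]

/-- The strictly proper part `a 0 λ⁻¹ + a 1 λ⁻² + ⋯` as a formal series. -/
def strictlyProperSeries : (ℕ → ℂ) →ₗ[ℂ] LaurentSeries ℂ where
  toFun a := HahnSeries.single 1 1 * HahnSeries.ofPowerSeries ℤ ℂ (PowerSeries.mk a)
  map_add' a b := by
    rw [← mul_add, ← map_add]
    rfl
  map_smul' t a := by
    rw [RingHom.id_apply, ← HahnSeries.C_mul_eq_smul, mul_left_comm,
      ← HahnSeries.ofPowerSeries_C, ← map_mul]
    congr 2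
    ext l
    simp

lemma coeff_strictlyProperSeries_succ (a : ℕ → ℂ) (l : ℕ) :
    (strictlyProperSeries a).coeff (l + 1) = a l := by
  change (HahnSeries.single (1 : ℤ) (1 : ℂ) * _).coeff _ = _
  rw [HahnSeries.coeff_single_mul_add, HahnSeries.ofPowerSeries_apply_coeff]
  simp

lemma coeff_strictlyProperSeries_of_nonpos (a : ℕ → ℂ) {e : ℤ} (he : e ≤ 0) :
    (strictlyProperSeries a).coeff e = 0 := by
  change (HahnSeries.single (1 : ℤ) (1 : ℂ) * _).coeff _ = _
  obtain ⟨b, rfl⟩ : ∃ b : ℤ, e = b + 1 := ⟨e - 1, by ring⟩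
  rw [HahnSeries.coeff_single_mul_add, one_mul, HahnSeries.ofPowerSeries_apply]
  apply HahnSeries.embDomain_of_notMem_range
  rintro ⟨l, hl⟩
  change (l : ℤ) = b at hl
  omega

/-- Multiplication by λ turns the first coefficient into a constant and shifts the others; this
makes the resolvent series telescope. -/
lemma single_neg_one_mul_strictlyProperSeries (a : ℕ → ℂ) :
    HahnSeries.single (-1 : ℤ) (1 : ℂ) * strictlyProperSeries a =
      HahnSeries.C (a 0) + strictlyProperSeries fun l => a (l + 1) := by
  ext e
  rw [coeff_single_neg_one_mul, HahnSeries.coeff_add]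
  rcases lt_trichotomy e 0 with he | rfl | he
  · rw [coeff_strictlyProperSeries_of_nonpos _ he.le,
      coeff_strictlyProperSeries_of_nonpos _ (by omega), HahnSeries.C_apply,
      HahnSeries.coeff_single_of_ne he.ne, add_zero]
  · have := coeff_strictlyProperSeries_succ a 0
    rw [coeff_strictlyProperSeries_of_nonpos _ le_rfl]
    simpa using this
  · obtain ⟨l, rfl⟩ : ∃ l : ℕ, e = l + 1 := ⟨(e - 1).toNat, by omega⟩
    have := coeff_strictlyProperSeries_succ a (l + 1)
    rw [coeff_strictlyProperSeries_succ, HahnSeries.C_apply,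
      HahnSeries.coeff_single_of_ne he.ne', zero_add, ← this]
    push_cast
    rfl

end Laurent

/-! ### From convergent expansions to formal ones. -/

section Analytic

/-- The Laurent series `f`, in the variable `z⁻¹`, converges to `v` at `z`. -/
def SumsTo (f : LaurentSeries ℂ) (z v : ℂ) : Prop :=
  HasSum (fun e : ℤ => f.coeff e * z ^ (-e)) v

namespace SumsTo

variable {f g : LaurentSeries ℂ} {z v w : ℂ}

lemma add (hf : SumsTo f z v) (hg : SumsTo g z w) : SumsTo (f + g) z (v + w) := by
  simpa [SumsTo, add_mul] using HasSum.add hf hg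

lemma sub (hf : SumsTo f z v) (hg : SumsTo g z w) : SumsTo (f - g) z (v - w) := by
  simpa [SumsTo, sub_mul] using HasSum.sub hf hg

lemma one (z : ℂ) : SumsTo 1 z 1 := by
  have := hasSum_single (f := fun e : ℤ => (1 : LaurentSeries ℂ).coeff e * z ^ (-e)) 0
    (fun e he => by simp [HahnSeries.coeff_one, he])
  rw [SumsTo]
  convert this using 1
  simp

lemma C_mul (a : ℂ) (hf : SumsTo f z v) : SumsTo (HahnSeries.C a * f) z (a * v) := by
  simpa [SumsTo, coeff_C_mul, mul_assoc] using HasSum.mul_left a hf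

lemma single_neg_one_pow_mul (hz : z ≠ 0) (b : ℕ) (hf : SumsTo f z v) :
    SumsTo (HahnSeries.single (-1 : ℤ) (1 : ℂ) ^ b * f) z (z ^ b * v) := by
  have h := (HasSum.mul_left (z ^ b) hf)
  rw [← (Equiv.addRight (b : ℤ)).hasSum_iff] at h
  have heq : ∀ e : ℤ, (HahnSeries.single (-1 : ℤ) (1 : ℂ) ^ b * f).coeff e * z ^ (-e) =
      z ^ b * (f.coeff (e + b) * z ^ (-(e + (b : ℤ)))) := by
    intro e
    rw [coeff_single_neg_one_pow_mul, neg_add, zpow_add₀ hz, _root_.zpow_neg z b, zpow_natCast]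
    field_simp
  rw [SumsTo, funext heq]
  exact h

lemma polynomial_mul (hz : z ≠ 0) (p : ℂ[X]) (hf : SumsTo f z v) :
    SumsTo (polynomialAtInfinity p * f) z (p.eval z * v) := by
  induction p using Polynomial.induction_on' with
  | add p q hp hq => simpa [add_mul] using hp.add hq
  | monomial b a =>
    rw [← Polynomial.C_mul_X_pow_eq_monomial]
    rw [map_mul, map_pow, polynomialAtInfinity_C, polynomialAtInfinity_X, mul_assoc,
      eval_C_mul, eval_pow, eval_X, mul_assoc]
    exact (hf.single_neg_one_pow_mul hz b).C_mul a

end SumsTo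

/-- A power series which vanishes at all small nonzero points has zero constant term. -/
lemma coeff_zero_eq_zero_of_hasSum {a : ℕ → ℂ} {δ : ℝ} (hδ : 0 < δ)
    (h : ∀ w : ℂ, w ≠ 0 → ‖w‖ < δ → HasSum (fun l => a l * w ^ l) 0) : a 0 = 0 := by
  have hw₀ : ((δ / 2 : ℝ) : ℂ) ≠ 0 := by exact_mod_cast (half_pos hδ).ne'
  have hn : ‖((δ / 2 : ℝ) : ℂ)‖ = δ / 2 := by
    rw [Complex.norm_real, Real.norm_of_nonneg (half_pos hδ).le]
  have hs : Summable fun l => ‖a l * ((δ / 2 : ℝ) : ℂ) ^ l‖ :=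
    (h _ hw₀ (by rw [hn]; linarith)).summable.norm
  -- Absolute convergence at δ/2 dominates the series on the smaller disc. The neighbourhood is
  -- punctured because nothing is assumed at 0.
  have hlim : Tendsto (fun w : ℂ => ∑' l, a l * w ^ l) (nhdsWithin 0 {0}ᶜ)
      (nhds (∑' l, a l * (0 : ℂ) ^ l)) := by
    refine tendsto_tsum_of_dominated_convergence hs (fun l => ?_) ?_
    · exact ((continuous_const.mul (continuous_pow l)).tendsto 0).mono_left nhdsWithin_le_nhds
    · filter_upwards [nhdsWithin_le_nhds (Metric.ball_mem_nhds (0 : ℂ) (half_pos hδ))] with w hw l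
      rw [norm_mul, norm_mul, norm_pow, norm_pow, hn]
      rw [mem_ball_zero_iff] at hw
      gcongr
  have h0 : Tendsto (fun w : ℂ => ∑' l, a l * w ^ l) (nhdsWithin 0 {0}ᶜ) (nhds 0) := by
    refine tendsto_const_nhds.congr' ?_
    filter_upwards [self_mem_nhdsWithin,
      nhdsWithin_le_nhds (Metric.ball_mem_nhds (0 : ℂ) hδ)] with w hw hw'
    exact (h w hw (by simpa using hw')).tsum_eq.symm
  have := tendsto_nhds_unique hlim h0
  rw [tsum_eq_single 0 (fun l hl => by simp [hl])] at this
  simpa using this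

/-- A Laurent series which converges to zero at all sufficiently large points is zero. -/
lemma eq_zero_of_sumsTo_zero {f : LaurentSeries ℂ} {ρ : ℝ}
    (h : ∀ z : ℂ, ρ < ‖z‖ → SumsTo f z 0) : f = 0 := by
  by_contra hf
  have hρ : 0 < max ρ 1 := lt_max_of_lt_right one_pos
  refine hf (HahnSeries.coeff_order_eq_zero.1 ?_)
  -- Substituting z = w⁻¹ and dividing by w to the power of the order gives a power series whose
  -- constant term is the leading coefficient of f.
  have := coeff_zero_eq_zero_of_hasSum (a := fun l => f.coeff (f.order + l))
    (inv_pos.2 hρ) fun w hw hw' => ?_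
  · simpa using this
  · have hlt : ρ < ‖w⁻¹‖ := by
      rw [norm_inv]
      refine (le_max_left ρ 1).trans_lt ?_
      rwa [lt_inv_comm₀ hρ (norm_pos_iff.2 hw)]
    have h1 : HasSum (fun e : ℤ => f.coeff e * w⁻¹ ^ (-e) * w ^ (-f.order)) 0 := by
      simpa using HasSum.mul_right (w ^ (-f.order)) (h _ hlt)
    have hinj : Function.Injective fun l : ℕ => f.order + (l : ℤ) := fun a b hab => by
      simpa using hab
    rw [← hinj.hasSum_iff] at h1
    · convert h1 using 2 with l
      simp only [Function.comp]
      rw [mul_assoc, _root_.inv_zpow, _root_.zpow_neg, inv_inv, ← zpow_add₀ hw]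
      simp
    · intro e he
      rw [HahnSeries.coeff_eq_zero_of_lt_order]
      · simp
      · by_contra hle
        exact he ⟨(e - f.order).toNat, by simp; omega⟩

/-- A convergent expansion at infinity agrees with the formal one. -/
theorem laurentAtInfinity_eq_strictlyProperSeries {x : RatFunc ℂ} {a : ℕ → ℂ} {ρ : ℝ}
    (h : ∀ z : ℂ, ρ < ‖z‖ →
      HasSum (fun l : ℕ => a l * (z ^ (l + 1))⁻¹) (RatFunc.eval (RingHom.id ℂ) z x)) :
    laurentAtInfinity x = strictlyProperSeries a := by
  -- The sum of the absolute values of the roots bounds each of them.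
  obtain ⟨σ, hσ⟩ : ∃ σ : ℝ, ∀ z : ℂ, σ < ‖z‖ → x.denom.eval z ≠ 0 := by
    refine ⟨∑ y ∈ x.denom.roots.toFinset, ‖y‖, fun z hz h0 => ?_⟩
    refine absurd (Finset.single_le_sum (f := fun y : ℂ => ‖y‖) (fun y _ => norm_nonneg y)
      (Multiset.mem_toFinset.2 ((mem_roots x.denom_ne_zero).2 h0))) (not_le.2 hz)
  -- Clearing the denominator leaves a Laurent series that converges to zero at all large z.
  have key : polynomialAtInfinity x.denom * strictlyProperSeries a -
      polynomialAtInfinity x.num * 1 = 0 := by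
    refine eq_zero_of_sumsTo_zero (ρ := max (max ρ σ) 0) fun z hz => ?_
    obtain ⟨⟨h1, h2⟩, h3⟩ : (ρ < ‖z‖ ∧ σ < ‖z‖) ∧ 0 < ‖z‖ := by simpa using hz
    have hz0 : z ≠ 0 := norm_pos_iff.1 h3
    have hs : SumsTo (strictlyProperSeries a) z (RatFunc.eval (RingHom.id ℂ) z x) := by
      have hinj : Function.Injective fun l : ℕ => (l : ℤ) + 1 := fun a b hab => by
        simpa using hab
      rw [SumsTo, ← hinj.hasSum_iff]
      · convert h z h1 using 2 with l
        simp only [Function.comp, coeff_strictlyProperSeries_succ, _root_.zpow_neg]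
        norm_cast
      · intro e he
        rw [coeff_strictlyProperSeries_of_nonpos, zero_mul]
        by_contra hle
        exact he ⟨(e - 1).toNat, by simp; omega⟩
    have := (hs.polynomial_mul hz0 x.denom).sub ((SumsTo.one z).polynomial_mul hz0 x.num)
    convert this using 1
    rw [RatFunc.eval, Polynomial.eval₂_id, Polynomial.eval₂_id, mul_div_cancel₀ _ (hσ z h2)]
    simp
  have hd : polynomialAtInfinity x.denom ≠ 0 := fun h0 =>
    x.denom_ne_zero (polynomialAtInfinity_injective (by simpa using h0))
  refine mul_left_cancel₀ hd ?_
  rw [sub_eq_zero, mul_one] at key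
  rw [key, ← laurentAtInfinity_algebraMap, ← laurentAtInfinity_algebraMap, ← map_mul]
  congr 1
  rw [mul_comm, ← eq_div_iff (by simpa using x.denom_ne_zero), RatFunc.num_div_denom]

end Analytic

/-! ### The Hankel operator and its rank. -/

section HankelOperator

/-- The coefficients of `λ⁻¹, λ⁻², …` in the Laurent expansion at infinity. -/
def strictlyProperCoeffs : RatFunc ℂ →ₗ[ℂ] (ℕ → ℂ) where
  toFun x l := (laurentAtInfinity x).coeff (l + 1)
  map_add' x y := by ext l; simp
  map_smul' a x := by
    ext l
    rw [Algebra.smul_def, map_mul, laurentAtInfinity_algebraMap_const, coeff_C_mul]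
    rfl

lemma strictlyProperCoeffs_apply (x : RatFunc ℂ) (l : ℕ) :
    strictlyProperCoeffs x l = (laurentAtInfinity x).coeff (l + 1) := rfl

lemma strictlyProperCoeffs_X_mul (x : RatFunc ℂ) (l : ℕ) :
    strictlyProperCoeffs (RatFunc.X * x) l = strictlyProperCoeffs x (l + 1) := by
  rw [strictlyProperCoeffs_apply, map_mul, laurentAtInfinity_X, coeff_single_neg_one_mul]
  rfl

lemma strictlyProperCoeffs_eq_zero_iff (x : RatFunc ℂ) :
    strictlyProperCoeffs x = 0 ↔ ∃ p : ℂ[X], algebraMap ℂ[X] (RatFunc ℂ) p = x := by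
  constructor
  · intro h
    obtain ⟨p, hp⟩ := exists_polynomialAtInfinity_eq (f := laurentAtInfinity x)
      fun l => congrFun h l
    exact ⟨p, laurentAtInfinity.injective (by simpa using hp)⟩
  · rintro ⟨p, rfl⟩
    ext l
    rw [strictlyProperCoeffs_apply, laurentAtInfinity_algebraMap, coeff_polynomialAtInfinity,
      if_neg (by omega)]
    rfl

variable {m n : ℕ}

/-- The Hankel operator of `R`: a polynomial vector `u` is sent to the strictly proper part of the
expansion at infinity of `R u`. -/
def hankelOperator (R : Matrix (Fin m) (Fin n) (RatFunc ℂ)) :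
    (Fin n → ℂ[X]) →ₗ[ℂ] (Fin m → ℕ → ℂ) where
  toFun u i := strictlyProperCoeffs ((R *ᵥ fun j => algebraMap ℂ[X] (RatFunc ℂ) (u j)) i)
  map_add' u v := by
    ext i l
    have : (fun j => algebraMap ℂ[X] (RatFunc ℂ) ((u + v) j)) =
      (fun j => algebraMap ℂ[X] (RatFunc ℂ) (u j)) +
        fun j => algebraMap ℂ[X] (RatFunc ℂ) (v j) := by ext1 j; simp
    rw [this, Matrix.mulVec_add, Pi.add_apply, map_add]
    rfl
  map_smul' a u := by
    ext i l
    have : (fun j => algebraMap ℂ[X] (RatFunc ℂ) ((a • u) j)) =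
      a • (fun j => algebraMap ℂ[X] (RatFunc ℂ) (u j)) := by
        ext1 j
        simp [Algebra.smul_def]
    rw [this, Matrix.mulVec_smul, Pi.smul_apply, map_smul]
    rfl

lemma hankelOperator_apply (R : Matrix (Fin m) (Fin n) (RatFunc ℂ)) (u : Fin n → ℂ[X])
    (i : Fin m) : hankelOperator R u i =
      strictlyProperCoeffs ((R *ᵥ fun j => algebraMap ℂ[X] (RatFunc ℂ) (u j)) i) := rfl

/-- This makes the range invariant under the shift, which becomes the state matrix of the
realization. -/
lemma hankelOperator_X_smul (R : Matrix (Fin m) (Fin n) (RatFunc ℂ)) (u : Fin n → ℂ[X])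
    (i : Fin m) (l : ℕ) :
    hankelOperator R ((Polynomial.X : ℂ[X]) • u) i l = hankelOperator R u i (l + 1) := by
  rw [hankelOperator_apply, hankelOperator_apply, ← strictlyProperCoeffs_X_mul]
  have : (fun j => algebraMap ℂ[X] (RatFunc ℂ) (((Polynomial.X : ℂ[X]) • u) j)) =
      (RatFunc.X : RatFunc ℂ) • (fun j => algebraMap ℂ[X] (RatFunc ℂ) (u j)) := by
    ext1 j
    simp
  rw [this, Matrix.mulVec_smul, Pi.smul_apply, smul_eq_mul]

lemma hankelOperator_single_one (R : Matrix (Fin m) (Fin n) (RatFunc ℂ)) (i : Fin m) (j : Fin n) :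
    hankelOperator R (Pi.single j 1) i = strictlyProperCoeffs (R i j) := by
  rw [hankelOperator_apply]
  have : (fun b => algebraMap ℂ[X] (RatFunc ℂ) ((Pi.single j 1 : Fin n → ℂ[X]) b)) =
      Pi.single j 1 := by
    ext1 b
    rcases eq_or_ne b j with rfl | h
    · simp
    · simp [h]
  rw [this, Matrix.mulVec_single_one]
  rfl

/-- An expansion with no negative powers of λ is that of a polynomial. In this form the kernel is
easy to follow under unimodular transformations. -/
lemma mem_ker_hankelOperator (R : Matrix (Fin m) (Fin n) (RatFunc ℂ)) (u : Fin n → ℂ[X]) :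
    u ∈ LinearMap.ker (hankelOperator R) ↔ ∃ v : Fin m → ℂ[X],
      (fun i => algebraMap ℂ[X] (RatFunc ℂ) (v i)) =
        R *ᵥ fun j => algebraMap ℂ[X] (RatFunc ℂ) (u j) := by
  rw [LinearMap.mem_ker, funext_iff]
  simp only [hankelOperator_apply, Pi.zero_apply, strictlyProperCoeffs_eq_zero_iff]
  rw [Classical.skolem]
  simp [funext_iff]

lemma map_mulVec_algebraMap {a b : ℕ} (M : Matrix (Fin a) (Fin b) ℂ[X]) (v : Fin b → ℂ[X]) :
    (fun i => algebraMap ℂ[X] (RatFunc ℂ) ((M *ᵥ v) i)) =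
      M.map (algebraMap ℂ[X] (RatFunc ℂ)) *ᵥ fun j => algebraMap ℂ[X] (RatFunc ℂ) (v j) := by
  ext1 i
  exact RingHom.map_mulVec (algebraMap ℂ[X] (RatFunc ℂ)) M v i

/-- The fraction ε u / ψ is polynomial exactly when ψ ∣ ε u, and coprimality removes ε. -/
lemma mem_ker_hankelOperator_diagQuotient {r : ℕ} {ε ψ : Fin r → ℂ[X]} (hm : r ≤ m) (hn : r ≤ n)
    (hψ : ∀ i, (ψ i).Monic) (hcop : ∀ i, IsCoprime (ε i) (ψ i)) (u : Fin n → ℂ[X]) :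
    u ∈ LinearMap.ker (hankelOperator (diagQuotient m n ε ψ)) ↔
      ∀ i : Fin r, ψ i ∣ u (Fin.castLE hn i) := by
  have hψ0 : ∀ i, algebraMap ℂ[X] (RatFunc ℂ) (ψ i) ≠ 0 := fun i => by simpa using (hψ i).ne_zero
  have hentry : ∀ i : Fin r, (diagQuotient m n ε ψ *ᵥ fun j => algebraMap ℂ[X] (RatFunc ℂ) (u j))
      (Fin.castLE hm i) = algebraMap ℂ[X] (RatFunc ℂ) (ε i) / algebraMap ℂ[X] (RatFunc ℂ) (ψ i) *
        algebraMap ℂ[X] (RatFunc ℂ) (u (Fin.castLE hn i)) := by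
    intro i
    rw [Matrix.mulVec, dotProduct, Finset.sum_eq_single (Fin.castLE hn i)]
    · simp [diagQuotient]
    · intro b _ hb
      have : ¬ (i.val = b.val) := fun h => hb (Fin.ext h.symm)
      simp [diagQuotient, this]
    · simp
  have hentry' : ∀ i : Fin m, r ≤ i.val →
      (diagQuotient m n ε ψ *ᵥ fun j => algebraMap ℂ[X] (RatFunc ℂ) (u j)) i = 0 := by
    intro i hi
    rw [Matrix.mulVec, dotProduct]
    refine Finset.sum_eq_zero fun b _ => ?_
    have : ¬ (i.val < r) := by omega
    simp [diagQuotient, this]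
  rw [mem_ker_hankelOperator]
  constructor
  · rintro ⟨v, hv⟩ i
    have h := congrFun hv (Fin.castLE hm i)
    rw [hentry, div_mul_eq_mul_div, eq_div_iff (hψ0 i), ← map_mul, ← map_mul] at h
    have h' := RatFunc.algebraMap_injective ℂ h
    exact (hcop i).symm.dvd_of_dvd_mul_left (h' ▸ Dvd.intro_left _ rfl)
  · intro h
    choose w hw using h
    refine ⟨fun i => if hi : i.val < r then ε ⟨i, hi⟩ * w ⟨i, hi⟩ else 0, ?_⟩
    ext1 i
    by_cases hi : i.val < r
    · have := hentry ⟨i, hi⟩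
      simp only [Fin.castLE_mk, Fin.eta] at this
      simp only [this, dif_pos hi]
      have hwi := hw ⟨i, hi⟩
      simp only [Fin.castLE_mk] at hwi
      rw [hwi, map_mul, map_mul]
      have := hψ0 ⟨i, hi⟩
      field_simp
    · simp only [hentry' i (by omega), dif_neg hi, map_zero]

/-- The rank of the Hankel operator is the total degree of the denominators in the
Smith--McMillan form. -/
theorem finrank_range_hankelOperator {R : Matrix (Fin m) (Fin n) (RatFunc ℂ)} {r : ℕ}
    {ε ψ : Fin r → ℂ[X]} (h : IsSmithMcMillanForm R ε ψ) :
    FiniteDimensional ℂ (LinearMap.range (hankelOperator R)) ∧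
      Module.finrank ℂ (LinearMap.range (hankelOperator R)) = ∑ i, (ψ i).natDegree := by
  obtain ⟨M, N, hM, hN, hMN⟩ := h.equivalent
  obtain ⟨M, rfl⟩ := hM
  obtain ⟨N, rfl⟩ := hN
  -- Reduces (N⁻¹u)ᵢ modulo ψᵢ. It is surjective with the kernel of the Hankel operator, so its
  -- target is a model of the range.
  let Φ : (Fin n → ℂ[X]) →ₗ[ℂ] (∀ i : Fin r, AdjoinRoot (ψ i)) :=
    LinearMap.pi fun i => ((AdjoinRoot.mkₐ (R := ℂ) (ψ i)).toLinearMap.comp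
      (LinearMap.proj (Fin.castLE h.le_cols i))).comp
        ((Matrix.mulVecLin (↑N⁻¹ : Matrix (Fin n) (Fin n) ℂ[X])).restrictScalars ℂ)
  have hΦ : ∀ u i, Φ u i = AdjoinRoot.mk (ψ i)
      (((↑N⁻¹ : Matrix (Fin n) (Fin n) ℂ[X]) *ᵥ u) (Fin.castLE h.le_cols i)) := fun u i => rfl
  have hsurj : Function.Surjective Φ := by
    intro y
    choose w hw using fun i => AdjoinRoot.mk_surjective (g := ψ i) (y i)
    refine ⟨(N : Matrix (Fin n) (Fin n) ℂ[X]) *ᵥ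
      fun j => if hj : j.val < r then w ⟨j, hj⟩ else 0, ?_⟩
    ext1 i
    rw [hΦ, Matrix.mulVec_mulVec, Units.inv_mul, Matrix.one_mulVec]
    simp [hw]
  have hker : LinearMap.ker Φ = LinearMap.ker (hankelOperator R) := by
    ext u
    set v := (↑N⁻¹ : Matrix (Fin n) (Fin n) ℂ[X]) *ᵥ u with hv
    have hu : u = (N : Matrix (Fin n) (Fin n) ℂ[X]) *ᵥ v := by
      rw [hv, Matrix.mulVec_mulVec, Units.mul_inv, Matrix.one_mulVec]
    have h1 : u ∈ LinearMap.ker Φ ↔ ∀ i : Fin r, ψ i ∣ v (Fin.castLE h.le_cols i) := by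
      rw [LinearMap.mem_ker, funext_iff]
      simp only [hΦ, Pi.zero_apply, AdjoinRoot.mk_eq_zero, ← hv]
    have h2 : diagQuotient m n ε ψ *ᵥ (fun j => algebraMap ℂ[X] (RatFunc ℂ) (v j)) =
        (M : Matrix (Fin m) (Fin m) ℂ[X]).map (algebraMap ℂ[X] (RatFunc ℂ)) *ᵥ
          (R *ᵥ fun j => algebraMap ℂ[X] (RatFunc ℂ) (u j)) := by
      have hu' : (fun j => algebraMap ℂ[X] (RatFunc ℂ) (u j)) =
          (N : Matrix (Fin n) (Fin n) ℂ[X]).map (algebraMap ℂ[X] (RatFunc ℂ)) *ᵥ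
            fun j => algebraMap ℂ[X] (RatFunc ℂ) (v j) := by
        rw [← map_mulVec_algebraMap, ← hu]
      rw [hu', ← hMN, Matrix.mulVec_mulVec, Matrix.mulVec_mulVec, Matrix.mul_assoc]
    have h3 : R *ᵥ (fun j => algebraMap ℂ[X] (RatFunc ℂ) (u j)) =
        (↑M⁻¹ : Matrix (Fin m) (Fin m) ℂ[X]).map (algebraMap ℂ[X] (RatFunc ℂ)) *ᵥ
          (diagQuotient m n ε ψ *ᵥ fun j => algebraMap ℂ[X] (RatFunc ℂ) (v j)) := by
      rw [h2, Matrix.mulVec_mulVec, ← Matrix.map_mul, Units.inv_mul,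
        Matrix.map_one _ (map_zero _) (map_one _), Matrix.one_mulVec]
    rw [h1, ← mem_ker_hankelOperator_diagQuotient h.le_rows h.le_cols h.monic_den h.coprime,
      mem_ker_hankelOperator, mem_ker_hankelOperator]
    constructor
    · rintro ⟨w, hw⟩
      exact ⟨(↑M⁻¹ : Matrix (Fin m) (Fin m) ℂ[X]) *ᵥ w, by
        rw [map_mulVec_algebraMap, hw, ← h3]⟩
    · rintro ⟨w, hw⟩
      exact ⟨(M : Matrix (Fin m) (Fin m) ℂ[X]) *ᵥ w, by
        rw [map_mulVec_algebraMap, hw, ← h2]⟩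
  let e : LinearMap.range (hankelOperator R) ≃ₗ[ℂ] (∀ i : Fin r, AdjoinRoot (ψ i)) :=
    (hankelOperator R).quotKerEquivRange.symm.trans
      ((Submodule.quotEquivOfEq _ _ hker.symm).trans (Φ.quotKerEquivOfSurjective hsurj))
  have hfin : ∀ i, Module.Finite ℂ (AdjoinRoot (ψ i)) := fun i =>
    (AdjoinRoot.powerBasis' (h.monic_den i)).finite
  have hfree : ∀ i, Module.Free ℂ (AdjoinRoot (ψ i)) := fun i => inferInstance
  refine ⟨Module.Finite.equiv e.symm, ?_⟩
  rw [e.finrank_eq, Module.finrank_pi_fintype]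
  exact Finset.sum_congr rfl fun i _ => by
    rw [(AdjoinRoot.powerBasis' (h.monic_den i)).finrank, AdjoinRoot.powerBasis'_dim]

end HankelOperator

/-! ### State space realizations and factorization of the Hankel matrices. -/

section Realization

variable {m n d : ℕ}

/-- The observability matrix with block rows `C, C A, …, C A ^ (k - 1)`. -/
def observabilityMatrix (C : Matrix (Fin m) (Fin d) ℂ) (A : Matrix (Fin d) (Fin d) ℂ) (k : ℕ) :
    Matrix (Fin k × Fin m) (Fin d) ℂ :=
  Matrix.of fun a s => (C * A ^ a.1.val) a.2 s

/-- The reachability matrix with block columns `B, A B, …, A ^ (k - 1) B`. -/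
def reachabilityMatrix (A : Matrix (Fin d) (Fin d) ℂ) (B : Matrix (Fin d) (Fin n) ℂ) (k : ℕ) :
    Matrix (Fin d) (Fin k × Fin n) ℂ :=
  Matrix.of fun s b => (A ^ b.1.val * B) s b.2

lemma reachabilityMatrix_transpose (A : Matrix (Fin d) (Fin d) ℂ) (B : Matrix (Fin d) (Fin n) ℂ)
    (k : ℕ) : (reachabilityMatrix A B k)ᵀ = observabilityMatrix Bᵀ Aᵀ k := by
  ext a s
  simp only [Matrix.transpose_apply, reachabilityMatrix, observabilityMatrix, Matrix.of_apply,
    ← Matrix.transpose_pow, ← Matrix.transpose_mul]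

lemma blockHankel_eq_mul {c : ℕ → Matrix (Fin m) (Fin n) ℂ} {A : Matrix (Fin d) (Fin d) ℂ}
    {B : Matrix (Fin d) (Fin n) ℂ} {C : Matrix (Fin m) (Fin d) ℂ}
    (h : ∀ l, c (l + 1) = C * A ^ l * B) (k : ℕ) :
    blockHankel c k = observabilityMatrix C A k * reachabilityMatrix A B k := by
  ext a b
  have : C * A ^ (a.1.val + b.1.val) * B = (C * A ^ a.1.val) * (A ^ b.1.val * B) := by
    simp only [pow_add, Matrix.mul_assoc]
  simp only [blockHankel, Matrix.of_apply, h, this]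
  rfl

lemma shiftedBlockHankel_eq_mul {c : ℕ → Matrix (Fin m) (Fin n) ℂ} {A : Matrix (Fin d) (Fin d) ℂ}
    {B : Matrix (Fin d) (Fin n) ℂ} {C : Matrix (Fin m) (Fin d) ℂ}
    (h : ∀ l, c (l + 1) = C * A ^ l * B) (k : ℕ) :
    shiftedBlockHankel c k = observabilityMatrix C A k * A * reachabilityMatrix A B k := by
  ext a b
  have : C * A ^ (a.1.val + b.1.val + 1) * B = (C * A ^ a.1.val) * A * (A ^ b.1.val * B) := by
    rw [add_right_comm, pow_add, pow_succ]
    simp only [Matrix.mul_assoc]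
  have h2 : c (a.1.val + b.1.val + 2) = _ := h (a.1.val + b.1.val + 1)
  simp only [shiftedBlockHankel, Matrix.of_apply, h2, this]
  rfl

lemma observabilityMatrix_mulVec_eq_zero_iff (C : Matrix (Fin m) (Fin d) ℂ)
    (A : Matrix (Fin d) (Fin d) ℂ) (k : ℕ) (x : Fin d → ℂ) :
    observabilityMatrix C A k *ᵥ x = 0 ↔ ∀ l < k, (C * A ^ l) *ᵥ x = 0 := by
  constructor
  · intro h l hl
    ext i
    exact congrFun h (⟨l, hl⟩, i)
  · intro h
    ext ⟨a, i⟩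
    exact congrFun (h a a.2) i

lemma rank_eq_of_mulVec_eq_zero {ι : Type*} [Fintype ι] {O : Matrix ι (Fin d) ℂ}
    (h : ∀ x, O *ᵥ x = 0 → x = 0) : O.rank = d := by
  have hinj : Function.Injective O.mulVecLin := by
    rw [← LinearMap.ker_eq_bot, LinearMap.ker_eq_bot']
    exact h
  rw [Matrix.rank, LinearMap.finrank_range_of_inj hinj, Module.finrank_fin_fun]

-- The Gram matrix O* O has the rank of O, hence is invertible, and its inverse times O* is a left
-- inverse.
open scoped ComplexOrder in
lemma exists_left_inverse_of_rank_eq {ι : Type*} [Fintype ι] {O : Matrix ι (Fin d) ℂ}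
    (h : O.rank = d) : ∃ O' : Matrix (Fin d) ι ℂ, O' * O = 1 := by
  have hr : (Oᴴ * O).rank = d := by rw [Matrix.rank_conjTranspose_mul_self, h]
  have htop : LinearMap.range (Oᴴ * O).mulVecLin = ⊤ :=
    Submodule.eq_top_of_finrank_eq (by rw [Module.finrank_fin_fun]; exact hr)
  obtain ⟨T, hT⟩ := Matrix.mulVec_surjective_iff_exists_right_inverse.1
    (LinearMap.range_eq_top.1 htop)
  exact ⟨T * Oᴴ, by rw [Matrix.mul_assoc]; exact mul_eq_one_comm.1 hT⟩

lemma exists_right_inverse_of_rank_eq {ι : Type*} [Fintype ι] {K : Matrix (Fin d) ι ℂ}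
    (h : K.rank = d) : ∃ K' : Matrix ι (Fin d) ℂ, K * K' = 1 := by
  obtain ⟨T, hT⟩ := exists_left_inverse_of_rank_eq (O := Kᵀ) (by rw [Matrix.rank_transpose, h])
  refine ⟨Tᵀ, ?_⟩
  rw [← Matrix.transpose_transpose K, ← Matrix.transpose_mul, hT, Matrix.transpose_one]

/-- The observability matrices of an observable pair have full column rank eventually. -/
lemma eventually_rank_observabilityMatrix {C : Matrix (Fin m) (Fin d) ℂ}
    {A : Matrix (Fin d) (Fin d) ℂ} (h : ∀ x, (∀ l, (C * A ^ l) *ᵥ x = 0) → x = 0) :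
    ∀ᶠ k in atTop, (observabilityMatrix C A k).rank = d := by
  -- The kernels decrease with k, hence stabilize; a vector in the stable kernel is killed by every
  -- C Aˡ.
  let f : ℕ →o (Submodule ℂ (Fin d → ℂ))ᵒᵈ :=
    { toFun := fun k => OrderDual.toDual (LinearMap.ker (observabilityMatrix C A k).mulVecLin)
      monotone' := fun k k' hk x hx => by
        have hx' : observabilityMatrix C A k' *ᵥ x = 0 := hx
        rw [observabilityMatrix_mulVec_eq_zero_iff] at hx'
        exact (observabilityMatrix_mulVec_eq_zero_iff C A k x).2
          fun l hl => hx' l (hl.trans_le hk) }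
  obtain ⟨k₀, hk₀⟩ := IsArtinian.monotone_stabilizes f
  have hker : ∀ k ≥ k₀, ∀ x, observabilityMatrix C A k₀ *ᵥ x = 0 →
      observabilityMatrix C A k *ᵥ x = 0 := fun k hk x hx => by
    have : x ∈ OrderDual.ofDual (f k) := (hk₀ k hk) ▸ hx
    exact this
  filter_upwards [eventually_ge_atTop k₀] with k hk
  refine rank_eq_of_mulVec_eq_zero fun x hx => h x fun l => ?_
  have hx₀ : observabilityMatrix C A k₀ *ᵥ x = 0 := by
    rw [observabilityMatrix_mulVec_eq_zero_iff] at hx ⊢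
    exact fun l hl => hx l (hl.trans_le hk)
  have := hker (max k₀ (l + 1)) (le_max_left _ _) x hx₀
  rw [observabilityMatrix_mulVec_eq_zero_iff] at this
  exact this l (lt_max_of_lt_right (Nat.lt_succ_self l))

/-- A reachable and observable realization of order equal to the polar degree. -/
theorem exists_realization {R : Matrix (Fin m) (Fin n) (RatFunc ℂ)}
    {c : ℕ → Matrix (Fin m) (Fin n) ℂ}
    (hc : ∀ i j, laurentAtInfinity (R i j) = strictlyProperSeries fun l => c (l + 1) i j)
    (hd : IsFinitePolarDegree R d) :
    ∃ (A : Matrix (Fin d) (Fin d) ℂ) (B : Matrix (Fin d) (Fin n) ℂ) (C : Matrix (Fin m) (Fin d) ℂ),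
      (∀ l, c (l + 1) = C * A ^ l * B) ∧
      (∀ x, (∀ l, (C * A ^ l) *ᵥ x = 0) → x = 0) ∧
      (∀ y, (∀ l, y ᵥ* (A ^ l * B) = 0) → y = 0) := by
  obtain ⟨r, ε, ψ, hSM, hdeg⟩ := hd
  obtain ⟨hfin, hrank⟩ := finrank_range_hankelOperator hSM
  rw [← hdeg] at hrank
  set W := LinearMap.range (hankelOperator R) with hW
  let b : Module.Basis (Fin d) ℂ W := Module.finBasisOfFinrankEq ℂ W hrank
  let shift : (Fin m → ℕ → ℂ) →ₗ[ℂ] (Fin m → ℕ → ℂ) :=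
    LinearMap.pi fun i => (LinearMap.funLeft ℂ ℂ Nat.succ).comp (LinearMap.proj i)
  have hshift : ∀ w i l, shift w i l = w i (l + 1) := fun _ _ _ => rfl
  have hshiftH : ∀ u, shift (hankelOperator R u) =
      hankelOperator R ((Polynomial.X : ℂ[X]) • u) := fun u => by
    ext i l
    rw [hshift, hankelOperator_X_smul]
  have hWshift : ∀ w ∈ W, shift w ∈ W := by
    rintro _ ⟨u, rfl⟩
    exact ⟨_, (hshiftH u).symm⟩
  let σ : W →ₗ[ℂ] W := shift.restrict hWshift
  let A := LinearMap.toMatrix b b σ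
  let H : (Fin n → ℂ[X]) →ₗ[ℂ] W := (hankelOperator R).rangeRestrict
  let B : Matrix (Fin d) (Fin n) ℂ := Matrix.of fun s j => b.repr (H (Pi.single j 1)) s
  let C : Matrix (Fin m) (Fin d) ℂ := Matrix.of fun i s => (b s : Fin m → ℕ → ℂ) i 0
  have hA : ∀ l (w : W), (A ^ l) *ᵥ b.repr w = b.repr ((σ ^ l) w) := by
    intro l
    induction l with
    | zero => intro w; simp
    | succ l ih =>
      intro w
      rw [pow_succ, ← Matrix.mulVec_mulVec, LinearMap.toMatrix_mulVec_repr, ih, pow_succ]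
      rfl
  have hσ : ∀ l (w : W) i a, ((σ ^ l) w : Fin m → ℕ → ℂ) i a = (w : Fin m → ℕ → ℂ) i (a + l) := by
    intro l
    induction l with
    | zero => intro w i a; rfl
    | succ l ih =>
      intro w i a
      rw [pow_succ', Module.End.mul_apply]
      change ((σ ^ l) w : Fin m → ℕ → ℂ) i (a + 1) = _
      rw [ih, add_assoc, add_comm 1 l]
  have hC : ∀ (w : W) i, (C *ᵥ b.repr w) i = (w : Fin m → ℕ → ℂ) i 0 := by
    intro w i
    have h := congrArg (fun v : W => (v : Fin m → ℕ → ℂ) i 0) (b.sum_repr w)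
    simp only [Submodule.coe_sum, Submodule.coe_smul, Finset.sum_apply, Pi.smul_apply,
      smul_eq_mul] at h
    rw [← h, Matrix.mulVec, dotProduct]
    exact Finset.sum_congr rfl fun s _ => mul_comm _ _
  -- The outputs C Aˡ recover every coefficient of the state, which gives both the factorization of
  -- `c` and observability.
  have hCA : ∀ l (w : W) i, ((C * A ^ l) *ᵥ b.repr w) i = (w : Fin m → ℕ → ℂ) i l := by
    intro l w i
    rw [← Matrix.mulVec_mulVec, hA, hC, hσ, zero_add]
  have hB : ∀ j, B.col j = b.repr (H (Pi.single j 1)) := fun j => rfl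
  have hX : ∀ l u, H ((Polynomial.X ^ l : ℂ[X]) • u) = (σ ^ l) (H u) := by
    intro l u
    induction l with
    | zero => simp
    | succ l ih =>
      rw [pow_succ', mul_smul, pow_succ', Module.End.mul_apply, ← ih]
      exact Subtype.ext (hshiftH _).symm
  refine ⟨A, B, C, fun l => ?_, fun x hx => ?_, fun y hy => ?_⟩
  · ext i j
    have h1 : (C * A ^ l * B) i j = ((C * A ^ l) *ᵥ B.col j) i := rfl
    rw [h1, hB, hCA]
    change _ = hankelOperator R (Pi.single j 1) i l
    rw [hankelOperator_single_one, strictlyProperCoeffs_apply, hc, coeff_strictlyProperSeries_succ]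
  · obtain ⟨w, rfl⟩ := b.equivFun.surjective x
    have hw : w = 0 := by
      ext i l
      rw [← hCA]
      exact congrFun (hx l) i
    rw [hw, map_zero]
  -- As a functional on W, y kills the images of all λˡ eⱼ; these span W, so y = 0.
  · let φ : W →ₗ[ℂ] ℂ := (dotProductBilin ℂ ℂ y).comp b.equivFun.toLinearMap
    have hφ : ∀ w, φ w = y ⬝ᵥ b.repr w := fun w => rfl
    have hzero : φ.comp H = 0 := by
      refine LinearMap.pi_ext' fun j => Polynomial.lhom_ext' fun l => LinearMap.ext_ring ?_
      simp only [LinearMap.comp_apply, LinearMap.zero_apply, LinearMap.single_apply]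
      have : (Pi.single j (Polynomial.monomial l (1 : ℂ)) : Fin n → ℂ[X]) =
          (Polynomial.X ^ l : ℂ[X]) • Pi.single j 1 := by
        rw [← Pi.single_smul, smul_eq_mul, mul_one, Polynomial.X_pow_eq_monomial]
      rw [this, hX, hφ, ← hA, ← hB]
      exact congrFun (hy l) j
    ext s
    have hs : φ (b s) = 0 := by
      obtain ⟨u, hu⟩ := (hankelOperator R).surjective_rangeRestrict (b s)
      rw [← hu]
      exact LinearMap.congr_fun hzero u
    rw [hφ, b.repr_self] at hs
    simpa [dotProduct, Finsupp.single_apply] using hs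

/-- The rank of the block Hankel matrices is eventually the polar degree. -/
theorem eventually_rank_blockHankel {R : Matrix (Fin m) (Fin n) (RatFunc ℂ)}
    {c : ℕ → Matrix (Fin m) (Fin n) ℂ}
    (hc : ∀ i j, laurentAtInfinity (R i j) = strictlyProperSeries fun l => c (l + 1) i j)
    (hd : IsFinitePolarDegree R d) : ∀ᶠ k in atTop, (blockHankel c k).rank = d := by
  obtain ⟨A, B, C, hreal, hobs, hreach⟩ := exists_realization hc hd
  have hreach' : ∀ᶠ k in atTop, (observabilityMatrix Bᵀ Aᵀ k).rank = d := by
    refine eventually_rank_observabilityMatrix fun y hy => hreach y fun l => ?_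
    rw [← Matrix.mulVec_transpose, Matrix.transpose_mul, Matrix.transpose_pow]
    exact hy l
  filter_upwards [eventually_rank_observabilityMatrix hobs, hreach'] with k hO hK
  rw [← reachabilityMatrix_transpose, Matrix.rank_transpose] at hK
  obtain ⟨O', hO'⟩ := exists_left_inverse_of_rank_eq hO
  rw [blockHankel_eq_mul hreal]
  refine le_antisymm ((Matrix.rank_mul_le_left _ _).trans hO.le) ?_
  calc d = (O' * (observabilityMatrix C A k * reachabilityMatrix A B k)).rank := by
        rw [← Matrix.mul_assoc, hO', Matrix.one_mul, hK]
    _ ≤ _ := Matrix.rank_mul_le_right _ _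

end Realization

/-! ### The transfer function of a realization. -/

section Transfer

variable {m n d : ℕ}

/-- The resolvent `(λ - A)⁻¹` expands as `Σ Aˡ λ^(-l-1)`. -/
lemma laurentAtInfinity_resolvent (A : Matrix (Fin d) (Fin d) ℂ) :
    ((RatFunc.X : RatFunc ℂ) • 1 - A.map (algebraMap ℂ (RatFunc ℂ))) *
        ((RatFunc.X : RatFunc ℂ) • 1 - A.map (algebraMap ℂ (RatFunc ℂ)))⁻¹ = 1 ∧
      (((RatFunc.X : RatFunc ℂ) • 1 - A.map (algebraMap ℂ (RatFunc ℂ)))⁻¹).map laurentAtInfinity =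
        Matrix.of fun s t => strictlyProperSeries fun l => (A ^ l) s t := by
  set T : Matrix (Fin d) (Fin d) (RatFunc ℂ) :=
    (RatFunc.X : RatFunc ℂ) • 1 - A.map (algebraMap ℂ (RatFunc ℂ)) with hT
  have hTchar : T = A.charmatrix.map (algebraMap ℂ[X] (RatFunc ℂ)) := by
    ext1 s t
    rcases eq_or_ne s t with rfl | h
    · simp [hT, RatFunc.algebraMap_X]
    · simp [hT, h]
  have hdet : IsUnit T.det := by
    rw [hTchar, ← RingHom.mapMatrix_apply, ← RingHom.map_det, isUnit_iff_ne_zero]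
    exact (map_ne_zero_iff _ (RatFunc.algebraMap_injective ℂ)).2 A.charpoly_monic.ne_zero
  have hmul : T * T⁻¹ = 1 := Matrix.mul_nonsing_inv _ hdet
  refine ⟨hmul, ?_⟩
  have h1 : T⁻¹.map laurentAtInfinity * T.map laurentAtInfinity = 1 := by
    rw [← Matrix.map_mul, Matrix.nonsing_inv_mul _ hdet,
      Matrix.map_one _ (map_zero _) (map_one _)]
  -- Telescoping: λ Σ Aˡ λ^(-l-1) − Σ A^(l+1) λ^(-l-1) = A⁰.
  have h2 : T.map laurentAtInfinity *
      (Matrix.of fun s t => strictlyProperSeries fun l => (A ^ l) s t) = 1 := by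
    have hTm : T.map laurentAtInfinity =
        Matrix.diagonal (fun _ => HahnSeries.single (-1 : ℤ) (1 : ℂ)) - A.map HahnSeries.C := by
      ext1 s t
      rw [Matrix.map_apply, hT, Matrix.sub_apply, Matrix.sub_apply, map_sub, Matrix.map_apply,
        Matrix.map_apply, laurentAtInfinity_algebraMap_const]
      rcases eq_or_ne s t with rfl | h
      · simp
      · simp [h]
    rw [hTm, Matrix.sub_mul]
    ext1 s t
    rw [Matrix.sub_apply, Matrix.diagonal_mul, Matrix.mul_apply]
    simp only [Matrix.of_apply, Matrix.map_apply]
    rw [single_neg_one_mul_strictlyProperSeries]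
    have : ∑ x, HahnSeries.C (A s x) * strictlyProperSeries (fun l => (A ^ l) x t) =
        strictlyProperSeries fun l => (A ^ (l + 1)) s t := by
      simp only [HahnSeries.C_mul_eq_smul, ← map_smul, ← map_sum]
      congr 1
      ext l
      simp [pow_succ', Matrix.mul_apply]
    rw [this, add_sub_cancel_right, pow_zero]
    rcases eq_or_ne s t with rfl | h
    · simp
    · simp [h]
  calc _ = T⁻¹.map laurentAtInfinity * (T.map laurentAtInfinity *
      (Matrix.of fun s t => strictlyProperSeries fun l => (A ^ l) s t)) := by rw [h2, mul_one]
    _ = _ := by rw [← Matrix.mul_assoc, h1, Matrix.one_mul]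

/-- The transfer function of a realization of the Laurent coefficients. -/
theorem eq_transfer_of_realization {R : Matrix (Fin m) (Fin n) (RatFunc ℂ)}
    {c : ℕ → Matrix (Fin m) (Fin n) ℂ}
    (hc : ∀ i j, laurentAtInfinity (R i j) = strictlyProperSeries fun l => c (l + 1) i j)
    {A : Matrix (Fin d) (Fin d) ℂ} {B : Matrix (Fin d) (Fin n) ℂ} {C : Matrix (Fin m) (Fin d) ℂ}
    (h : ∀ l, c (l + 1) = C * A ^ l * B) :
    R = C.map (algebraMap ℂ (RatFunc ℂ)) *
      ((RatFunc.X : RatFunc ℂ) • 1 - A.map (algebraMap ℂ (RatFunc ℂ)))⁻¹ *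
        B.map (algebraMap ℂ (RatFunc ℂ)) := by
  refine Matrix.map_injective laurentAtInfinity.injective ?_
  beta_reduce
  rw [Matrix.map_mul, Matrix.map_mul, (laurentAtInfinity_resolvent A).2]
  ext1 i j
  simp only [Matrix.map_apply, hc, h, Matrix.mul_apply, Matrix.of_apply,
    laurentAtInfinity_algebraMap_const]
  simp only [mul_comm _ (HahnSeries.C (B _ _)), HahnSeries.C_mul_eq_smul, ← map_smul, ← map_sum]
  congr 1
  ext l
  simp [mul_comm]

end Transfer

/-! ### Strong minimality and transfer function under strict equivalence. -/

section Pencil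

variable {m n d k : ℕ}

lemma rank_eq_of_vecMul_eq_zero {ι : Type*} [Fintype ι] {K : Matrix (Fin d) ι ℂ}
    (h : ∀ y, y ᵥ* K = 0 → y = 0) : K.rank = d := by
  rw [← Matrix.rank_transpose]
  exact rank_eq_of_mulVec_eq_zero fun y hy => h y (by rwa [← Matrix.mulVec_transpose])

/-- If `[A - z; C]` is not injective then neither is an observability matrix. -/
lemma eq_zero_of_observabilityMatrix {C : Matrix (Fin m) (Fin d) ℂ} {A : Matrix (Fin d) (Fin d) ℂ}
    (hO : (observabilityMatrix C A k).rank = d) {z : ℂ} {x : Fin d → ℂ}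
    (hA : A *ᵥ x = z • x) (hC : C *ᵥ x = 0) : x = 0 := by
  obtain ⟨O', hO'⟩ := exists_left_inverse_of_rank_eq hO
  have hpow : ∀ l, (A ^ l) *ᵥ x = z ^ l • x := by
    intro l
    induction l with
    | zero => simp
    | succ l ih =>
      rw [pow_succ, ← Matrix.mulVec_mulVec, hA, Matrix.mulVec_smul, ih, smul_smul, pow_succ']
  have h0 : observabilityMatrix C A k *ᵥ x = 0 :=
    (observabilityMatrix_mulVec_eq_zero_iff C A k x).2 fun l _ => by
      rw [← Matrix.mulVec_mulVec, hpow, Matrix.mulVec_smul, hC, smul_zero]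
  rw [← Matrix.one_mulVec x, ← hO', ← Matrix.mulVec_mulVec, h0, Matrix.mulVec_zero]

lemma eq_zero_of_reachabilityMatrix {A : Matrix (Fin d) (Fin d) ℂ} {B : Matrix (Fin d) (Fin n) ℂ}
    (hK : (reachabilityMatrix A B k).rank = d) {z : ℂ} {y : Fin d → ℂ}
    (hA : y ᵥ* A = z • y) (hB : y ᵥ* B = 0) : y = 0 := by
  rw [← Matrix.rank_transpose, reachabilityMatrix_transpose] at hK
  exact eq_zero_of_observabilityMatrix hK (by rwa [Matrix.mulVec_transpose])
    (by rwa [Matrix.mulVec_transpose])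

/-- A pencil strictly equivalent to `[A - λ, B; C, 0]` with `(A, B, C)` reachable and observable is
strongly minimal. -/
theorem isStronglyMinimal_of_realization {A P Q S Hhat : Matrix (Fin d) (Fin d) ℂ}
    {B : Matrix (Fin d) (Fin n) ℂ} {C Z : Matrix (Fin m) (Fin d) ℂ} {W : Matrix (Fin n) (Fin d) ℂ}
    (hP : IsUnit P) (hQ : IsUnit Q) (hH : Hhat = P * Q) (hS : S = P * A * Q)
    (hB : Hhat * Wᴴ = P * B) (hC : Z * Hhat = C * Q)
    (hO : (observabilityMatrix C A k).rank = d) (hK : (reachabilityMatrix A B k).rank = d) :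
    IsStronglyMinimal (hankelPencil S Hhat Z W) := by
  have hHu : IsUnit Hhat := hH ▸ hP.mul hQ
  have heval : ∀ z : ℂ, (S.map Polynomial.C - (Polynomial.X : ℂ[X]) • Hhat.map Polynomial.C).map
      (Polynomial.eval z) = P * (A - z • 1) * Q := by
    intro z
    have : (S.map Polynomial.C - (Polynomial.X : ℂ[X]) • Hhat.map Polynomial.C).map
      (Polynomial.eval z) = S - z • Hhat := by ext s t; simp; ring
    rw [this, hS, hH, Matrix.mul_sub, Matrix.sub_mul]
    simp
  -- This block is invertible, so it alone gives both rank conditions at infinity.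
  have hcoeff : (S.map Polynomial.C - (Polynomial.X : ℂ[X]) • Hhat.map Polynomial.C).map
      (fun q => q.coeff 1) = -Hhat := by
    ext s t
    simp [Polynomial.coeff_C]
  have hneg : IsUnit (-Hhat) := hHu.neg
  refine ⟨fun z => ?_, fun z => ?_, ?_, ?_⟩
  · have : (fromCols (hankelPencil S Hhat Z W).toBlocks₁₁ (hankelPencil S Hhat Z W).toBlocks₁₂).map
        (Polynomial.eval z) = fromCols (P * (A - z • 1) * Q) (P * B) := by
      rw [← heval, ← hB]
      ext s (t | t) <;> simp [hankelPencil, -Matrix.map_mul]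
    rw [this]
    refine rank_eq_of_vecMul_eq_zero fun y hy => ?_
    rw [Matrix.vecMul_fromCols] at hy
    have h1 : y ᵥ* (P * (A - z • 1) * Q) = 0 := funext fun s => congrFun hy (Sum.inl s)
    have h2 : y ᵥ* (P * B) = 0 := funext fun s => congrFun hy (Sum.inr s)
    -- A nonzero y P would be a left eigenvector of A annihilated by B, contradicting the rank of
    -- the reachability matrix. The column case is dual.
    have h3 : (y ᵥ* P) ᵥ* (A - z • 1) = 0 := by
      refine Matrix.vecMul_injective_of_isUnit hQ ?_
      simpa [Matrix.vecMul_vecMul, Matrix.mul_assoc] using h1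
    have h4 : y ᵥ* P = 0 := by
      refine eq_zero_of_reachabilityMatrix hK (z := z) ?_ (by rwa [Matrix.vecMul_vecMul])
      rwa [Matrix.vecMul_sub, Matrix.vecMul_smul, Matrix.vecMul_one, sub_eq_zero] at h3
    exact Matrix.vecMul_injective_of_isUnit hP (by simpa using h4)
  · have : (fromRows (hankelPencil S Hhat Z W).toBlocks₁₁ (hankelPencil S Hhat Z W).toBlocks₂₁).map
        (Polynomial.eval z) = fromRows (P * (A - z • 1) * Q) (C * Q) := by
      rw [← heval, ← hC]
      ext (s | s) t <;> simp [hankelPencil, -Matrix.map_mul]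
    rw [this]
    refine rank_eq_of_mulVec_eq_zero fun x hx => ?_
    rw [Matrix.fromRows_mulVec] at hx
    have h1 : (P * (A - z • 1) * Q) *ᵥ x = 0 := funext fun s => congrFun hx (Sum.inl s)
    have h2 : (C * Q) *ᵥ x = 0 := funext fun s => congrFun hx (Sum.inr s)
    have h3 : (A - z • 1) *ᵥ (Q *ᵥ x) = 0 := by
      refine Matrix.mulVec_injective_of_isUnit hP ?_
      simpa [Matrix.mulVec_mulVec, Matrix.mul_assoc] using h1
    have h4 : Q *ᵥ x = 0 := by
      refine eq_zero_of_observabilityMatrix hO (z := z) ?_ (by rwa [Matrix.mulVec_mulVec])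
      rwa [Matrix.sub_mulVec, Matrix.smul_mulVec, Matrix.one_mulVec, sub_eq_zero] at h3
    exact Matrix.mulVec_injective_of_isUnit hQ (by simpa using h4)
  · refine rank_eq_of_vecMul_eq_zero fun y hy => ?_
    have h1 : y ᵥ* (-Hhat) = 0 := by
      rw [← hcoeff]
      exact funext fun s => congrFun hy (Sum.inl s)
    exact Matrix.vecMul_injective_of_isUnit hneg (by simpa using h1)
  · refine rank_eq_of_mulVec_eq_zero fun x hx => ?_
    have h1 : (-Hhat) *ᵥ x = 0 := by
      rw [← hcoeff]
      exact funext fun s => congrFun hx (Sum.inl s)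
    exact Matrix.mulVec_injective_of_isUnit hneg (by simpa using h1)

/-- The transfer function is unchanged under strict equivalence. -/
lemma transfer_strictEquiv {K : Type*} [Field K] {T P Q : Matrix (Fin d) (Fin d) K}
    (hP : IsUnit P) (hQ : IsUnit Q) (B : Matrix (Fin d) (Fin n) K) (C : Matrix (Fin m) (Fin d) K) :
    (C * Q) * (P * T * Q)⁻¹ * (P * B) = C * T⁻¹ * B := by
  rw [Matrix.isUnit_iff_isUnit_det] at hP hQ
  rw [Matrix.mul_inv_rev, Matrix.mul_inv_rev]
  calc _ = C * (Q * Q⁻¹) * T⁻¹ * (P⁻¹ * P) * B := by simp only [Matrix.mul_assoc]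
    _ = _ := by rw [Matrix.mul_nonsing_inv _ hQ, Matrix.nonsing_inv_mul _ hP]; simp

/-- A pencil strictly equivalent to `[A - λ, B; C, 0]` is a linear system matrix for
`C (λ - A)⁻¹ B`. -/
theorem isLinearSystemMatrix_of_realization {R : Matrix (Fin m) (Fin n) (RatFunc ℂ)}
    {A P Q S Hhat : Matrix (Fin d) (Fin d) ℂ}
    {B : Matrix (Fin d) (Fin n) ℂ} {C Z : Matrix (Fin m) (Fin d) ℂ} {W : Matrix (Fin n) (Fin d) ℂ}
    (hP : IsUnit P) (hQ : IsUnit Q) (hH : Hhat = P * Q) (hS : S = P * A * Q)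
    (hB : Hhat * Wᴴ = P * B) (hC : Z * Hhat = C * Q)
    (hR : R = C.map (algebraMap ℂ (RatFunc ℂ)) *
      ((RatFunc.X : RatFunc ℂ) • 1 - A.map (algebraMap ℂ (RatFunc ℂ)))⁻¹ *
        B.map (algebraMap ℂ (RatFunc ℂ))) :
    IsLinearSystemMatrix (hankelPencil S Hhat Z W) R ∧
      R = (Z * Hhat).map (algebraMap ℂ (RatFunc ℂ)) *
          ((RatFunc.X : RatFunc ℂ) • Hhat.map (algebraMap ℂ (RatFunc ℂ)) -
            S.map (algebraMap ℂ (RatFunc ℂ)))⁻¹ *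
          (Hhat * Wᴴ).map (algebraMap ℂ (RatFunc ℂ)) := by
  set ι := algebraMap ℂ (RatFunc ℂ) with hι
  have hP' : IsUnit (P.map ι) := hP.map ι.mapMatrix
  have hQ' : IsUnit (Q.map ι) := hQ.map ι.mapMatrix
  set T : Matrix (Fin d) (Fin d) (RatFunc ℂ) := (RatFunc.X : RatFunc ℂ) • 1 - A.map ι with hT
  have hTunit : IsUnit T := IsUnit.of_mul_eq_one _ (laurentAtInfinity_resolvent A).1
  have hpencil : (RatFunc.X : RatFunc ℂ) • Hhat.map ι - S.map ι = P.map ι * T * Q.map ι := by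
    rw [hT, hH, hS, Matrix.mul_sub, Matrix.sub_mul]
    simp [Matrix.map_mul]
  have hformula : R = (Z * Hhat).map ι * ((RatFunc.X : RatFunc ℂ) • Hhat.map ι - S.map ι)⁻¹ *
      (Hhat * Wᴴ).map ι := by
    rw [hpencil, hB, hC, Matrix.map_mul, Matrix.map_mul, transfer_strictEquiv hP' hQ', hR]
  have hconst : ∀ a : ℂ, algebraMap ℂ[X] (RatFunc ℂ) (Polynomial.C a) = ι a := fun a => rfl
  have hblock : (S.map Polynomial.C - (Polynomial.X : ℂ[X]) • Hhat.map Polynomial.C).map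
      (algebraMap ℂ[X] (RatFunc ℂ)) = -((RatFunc.X : RatFunc ℂ) • Hhat.map ι - S.map ι) := by
    ext1 s t
    simp only [Matrix.map_apply, Matrix.sub_apply, Matrix.smul_apply, Matrix.neg_apply,
      smul_eq_mul, map_sub, map_mul, hconst, RatFunc.algebraMap_X, neg_sub]
  have hunit : IsUnit ((RatFunc.X : RatFunc ℂ) • Hhat.map ι - S.map ι) :=
    hpencil ▸ (hP'.mul hTunit).mul hQ'
  refine ⟨⟨?_, ?_, ?_⟩, hformula⟩
  · rintro (s | s) (t | t)
    · simp only [hankelPencil, Matrix.fromBlocks_apply₁₁, Matrix.sub_apply, Matrix.map_apply,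
        Matrix.smul_apply, smul_eq_mul]
      compute_degree
    · simp [hankelPencil, -Matrix.map_mul]
    · simp [hankelPencil, -Matrix.map_mul]
    · simp [hankelPencil]
  · rw [hankelPencil, Matrix.toBlocks_fromBlocks₁₁]
    intro h0
    have h1 := congrArg (algebraMap ℂ[X] (RatFunc ℂ)) h0
    rw [RingHom.map_det, RingHom.mapMatrix_apply, hblock, map_zero] at h1
    exact ((Matrix.isUnit_iff_isUnit_det _).1 hunit.neg).ne_zero h1
  · have hBm : (-(Hhat * Wᴴ).map Polynomial.C).map (algebraMap ℂ[X] (RatFunc ℂ)) =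
        -(Hhat * Wᴴ).map ι := by
      ext1 s t
      simp only [Matrix.map_apply, Matrix.neg_apply, map_neg, hconst]
    have hCm : ((Z * Hhat).map Polynomial.C).map (algebraMap ℂ[X] (RatFunc ℂ)) =
        (Z * Hhat).map ι := rfl
    -- Two signs cancel: the leading block is −(λĤ − S), and the transfer function uses the negated
    -- upper right block.
    have hinv : (-((RatFunc.X : RatFunc ℂ) • Hhat.map ι - S.map ι))⁻¹ =
        -((RatFunc.X : RatFunc ℂ) • Hhat.map ι - S.map ι)⁻¹ := by
      refine Matrix.inv_eq_right_inv ?_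
      rw [neg_mul_neg, Matrix.mul_nonsing_inv _ ((Matrix.isUnit_iff_isUnit_det _).1 hunit)]
    rw [hankelPencil, Matrix.toBlocks_fromBlocks₁₁, Matrix.toBlocks_fromBlocks₁₂,
      Matrix.toBlocks_fromBlocks₂₁, Matrix.toBlocks_fromBlocks₂₂, hblock, hBm, hCm, hinv,
      Matrix.map_zero _ (map_zero _), zero_add, Matrix.mul_neg, Matrix.mul_neg, Matrix.neg_mul,
      neg_neg]
    exact hformula

end Pencil

end

/-! ### The main theorem. -/

theorem mainTheorem5 {m n : ℕ} (R : Matrix (Fin m) (Fin n) (RatFunc ℂ)) (hR : IsStrictlyProper R)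
    (c : ℕ → Matrix (Fin m) (Fin n) ℂ) (hc : HasLaurentExpansionAtInfinity R c) :
    (∀ᶠ k : ℕ in atTop, IsFinitePolarDegree R (blockHankel c k).rank) ∧
    ∀ (k : ℕ) (hk : 0 < k) (r : ℕ), r = (blockHankel c k).rank → IsFinitePolarDegree R r →
      ∀ (s t : ℕ)
        (U₁ : Matrix (Fin k × Fin m) (Fin r) ℂ) (U₂ : Matrix (Fin k × Fin m) (Fin s) ℂ)
        (V₁ : Matrix (Fin k × Fin n) (Fin r) ℂ) (V₂ : Matrix (Fin k × Fin n) (Fin t) ℂ)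
        (Hhat : Matrix (Fin r) (Fin r) ℂ),
        IsUnitaryMatrix (fromCols U₁ U₂) → IsUnitaryMatrix (fromCols V₁ V₂) →
        (fromCols U₁ U₂)ᴴ * blockHankel c k * fromCols V₁ V₂ = fromBlocks Hhat 0 0 0 →
        IsUnit Hhat →
        IsStronglyMinimalLinearization
          (hankelPencil (U₁ᴴ * shiftedBlockHankel c k * V₁) Hhat
            (firstBlockRow hk U₁) (firstBlockRow hk V₁)) R ∧
        R = (firstBlockRow hk U₁ * Hhat).map (algebraMap ℂ (RatFunc ℂ)) *
          ((RatFunc.X : RatFunc ℂ) • Hhat.map (algebraMap ℂ (RatFunc ℂ)) -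
            (U₁ᴴ * shiftedBlockHankel c k * V₁).map (algebraMap ℂ (RatFunc ℂ)))⁻¹ *
          (Hhat * (firstBlockRow hk V₁)ᴴ).map (algebraMap ℂ (RatFunc ℂ)) := by
  obtain ⟨ρ, hρ⟩ := hc
  have hc' : ∀ i j, laurentAtInfinity (R i j) = strictlyProperSeries fun l => c (l + 1) i j :=
    fun i j => laurentAtInfinity_eq_strictlyProperSeries fun z hz => hρ z hz i j
  refine ⟨?_, ?_⟩
  · obtain ⟨r, ε, ψ, h⟩ := exists_smithMcMillanForm R
    have hd : IsFinitePolarDegree R (∑ i, (ψ i).natDegree) := ⟨r, ε, ψ, h, rfl⟩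
    filter_upwards [eventually_rank_blockHankel hc' hd] with k hk
    rwa [hk]
  intro k hk r hr hd s t U₁ U₂ V₁ V₂ Hhat hU hV hUV hHhat
  obtain ⟨A, B, C, hreal, -, -⟩ := exists_realization hc' hd
  have hHOK := blockHankel_eq_mul hreal k
  set O := observabilityMatrix C A k with hOdef
  set K := reachabilityMatrix A B k with hKdef
  -- The r states bound the ranks of O and K from above, and rank H = r bounds them from below, so
  -- the given k already suffices.
  have hO : O.rank = r := le_antisymm
    ((Matrix.rank_le_card_width _).trans_eq (Fintype.card_fin _))
    (hr.le.trans (hHOK ▸ Matrix.rank_mul_le_left _ _))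
  have hK : K.rank = r := le_antisymm
    ((Matrix.rank_le_card_height _).trans_eq (Fintype.card_fin _))
    (hr.le.trans (hHOK ▸ Matrix.rank_mul_le_right _ _))
  obtain ⟨O', hO'⟩ := exists_left_inverse_of_rank_eq hO
  obtain ⟨K', hK'⟩ := exists_right_inverse_of_rank_eq hK
  rw [Matrix.conjTranspose_fromCols_eq_fromRows_conjTranspose, Matrix.fromRows_mul,
    Matrix.fromRows_mul_fromCols, Matrix.fromBlocks_inj] at hUV
  obtain ⟨h11, h12, h21, h22⟩ := hUV
  have hUU : U₁ * U₁ᴴ + U₂ * U₂ᴴ = 1 := by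
    rw [← hU.2, Matrix.conjTranspose_fromCols_eq_fromRows_conjTranspose,
      Matrix.fromCols_mul_fromRows]
  have hVV : V₁ * V₁ᴴ + V₂ * V₂ᴴ = 1 := by
    rw [← hV.2, Matrix.conjTranspose_fromCols_eq_fromRows_conjTranspose,
      Matrix.fromCols_mul_fromRows]
  -- The zero blocks give U₂* H = 0 because [V₁ V₂] is unitary; K is then cancelled from H = O K by
  -- its right inverse.
  have hU₂O : U₂ᴴ * O = 0 := by
    have : U₂ᴴ * blockHankel c k = 0 := by
      rw [← Matrix.mul_one (U₂ᴴ * blockHankel c k), ← hVV, Matrix.mul_add, ← Matrix.mul_assoc,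
        ← Matrix.mul_assoc, h21, h22, Matrix.zero_mul, Matrix.zero_mul, add_zero]
    rw [← Matrix.mul_one (U₂ᴴ * O), ← hK', ← Matrix.mul_assoc, Matrix.mul_assoc U₂ᴴ, ← hHOK, this,
      Matrix.zero_mul]
  have hKV₂ : K * V₂ = 0 := by
    have : blockHankel c k * V₂ = 0 := by
      rw [← Matrix.one_mul (blockHankel c k * V₂), ← hUU, Matrix.add_mul, Matrix.mul_assoc,
        Matrix.mul_assoc, ← Matrix.mul_assoc U₁ᴴ, ← Matrix.mul_assoc U₂ᴴ, h12, h22,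
        Matrix.mul_zero, Matrix.mul_zero, add_zero]
    rw [← Matrix.one_mul (K * V₂), ← hO', Matrix.mul_assoc, ← Matrix.mul_assoc O, ← hHOK, this,
      Matrix.mul_zero]
  have hOP : U₁ * (U₁ᴴ * O) = O := by
    have h := congrArg (· * O) hUU
    simpa only [Matrix.add_mul, Matrix.mul_assoc, hU₂O, Matrix.mul_zero, add_zero,
      Matrix.one_mul] using h
  have hQK : (K * V₁) * V₁ᴴ = K := by
    have h := congrArg (K * ·) hVV
    simpa only [Matrix.mul_add, ← Matrix.mul_assoc, hKV₂, Matrix.zero_mul, add_zero,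
      Matrix.mul_one] using h
  have hH : Hhat = (U₁ᴴ * O) * (K * V₁) := by
    rw [← h11, hHOK]
    simp only [Matrix.mul_assoc]
  have hdet : IsUnit ((U₁ᴴ * O).det * (K * V₁).det) := by
    rw [← Matrix.det_mul, ← hH]
    exact (Matrix.isUnit_iff_isUnit_det _).1 hHhat
  have hP : IsUnit (U₁ᴴ * O) := (Matrix.isUnit_iff_isUnit_det _).2 (isUnit_of_mul_isUnit_left hdet)
  have hQ : IsUnit (K * V₁) := (Matrix.isUnit_iff_isUnit_det _).2 (isUnit_of_mul_isUnit_right hdet)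
  have hS : U₁ᴴ * shiftedBlockHankel c k * V₁ = (U₁ᴴ * O) * A * (K * V₁) := by
    rw [shiftedBlockHankel_eq_mul hreal]
    simp only [Matrix.mul_assoc, hOdef, hKdef]
  -- Compares first block columns in K V₁V₁* = K; that of K is A⁰B = B.
  have hQW : (K * V₁) * (firstBlockRow hk V₁)ᴴ = B := by
    ext s j
    have h := congrFun (congrFun hQK s) (⟨0, hk⟩, j)
    have hB : K s (⟨0, hk⟩, j) = B s j := by simp [hKdef, reachabilityMatrix]
    rw [← hB, ← h]
    rfl
  have hZP : firstBlockRow hk U₁ * (U₁ᴴ * O) = C := by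
    ext i s
    have h := congrFun (congrFun hOP (⟨0, hk⟩, i)) s
    have hC : O (⟨0, hk⟩, i) s = C i s := by simp [hOdef, observabilityMatrix]
    rw [← hC, ← h]
    rfl
  have hB : Hhat * (firstBlockRow hk V₁)ᴴ = (U₁ᴴ * O) * B := by
    rw [hH, Matrix.mul_assoc, hQW]
  have hC : firstBlockRow hk U₁ * Hhat = C * (K * V₁) := by
    rw [hH, ← Matrix.mul_assoc, hZP]
  obtain ⟨hlin, hformula⟩ := isLinearSystemMatrix_of_realization hP hQ hH hS hB hC
    (eq_transfer_of_realization hc' hreal)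
  exact ⟨⟨hlin, isStronglyMinimal_of_realization hP hQ hH hS hB hC hO hK⟩, hformula⟩
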